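/- Let $f$ be a complex-valued function which is holomorphic on an open neighbourhood of a point $z_0\in\mathbb C$, and suppose that $z_0$ is an attracting fixed point of $f$, i.e. $f(z_0)=z_0$ and $\lambda:=f'(z_0)$ satisfies $0<|\lambda|<1$. Let $U$ be a Koenigs linearization neighbourhood of $z_0$: $U$ is an open neighbourhood of $z_0$ on which $f$ is holomorphic, $f(U)\subset U$, and there are an open neighbourhood $V$ of $0$ and a conformal (i.e. bijective holomorphic) map $\varphi:U\to V$ with $\varphi(f(z))=\lambda\,\varphi(z)$ for all $z\in U$. For an open set $\Omega\subset\mathbb C$ let $H(\Omega)$ be the space of holomorphic functions $\Omega\to\mathbb C$ with the topology of locally uniform convergence, and let $f^n$ be the $n$-th iterate of $f$. For an open set $W\subset U\setminus\{z_0\}$, a function $g\in H(\mathbb C\setminus\{z_0\})$ is called $H(W)$-universal for $C_f$ if the closure of $\{g\circ f^n|_W : n=1,2,\dots\}$ in the space $C(W)$ of continuous functions $W\to\mathbb C$, with the topology of locally uniform convergence, contains $H(W)$ (equivalently, if this set is dense in $H(W)$). A set $W\subset\mathbb C$ has no holes if every connected component of $(\mathbb C\cup\{\infty\})\setminus W$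 contains $\infty$. Then the set of all $g\in H(\mathbb C\setminus\{z_0\})$ which are $H(W)$-universal for $C_f$ for every open set $W\subset U\setminus\{z_0\}$ without holes is comeager in $H(\mathbb C\setminus\{z_0\})$, i.e. it contains a dense $G_\delta$-set. -/

import Mathlib

open Set Function Topology

/-- `H(Ω)`: the continuous functions `Ω → ℂ` which are holomorphic (used for open `Ω ⊆ ℂ`).
As a subspace of `C(Ω, ℂ)` with its compact-open topology, it carries the topology of
locally uniform convergence. -/
def Hol (Ω : Set ℂ) : Set C(Ω, ℂ) :=
  {g | ∃ G : ℂ → ℂ, DifferentiableOn ℂ G Ω ∧ ∀ z : Ω, G z = g z}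

/-- A hole of `M ⊆ ℂ`: a connected component of the complement of `M` in the extended plane
`ℂ ∪ {∞}` which does not contain `∞`. -/
def IsHole (M : Set ℂ) (H : Set (OnePoint ℂ)) : Prop :=
  (∃ x ∈ ((↑) '' M : Set (OnePoint ℂ))ᶜ,
    H = connectedComponentIn ((↑) '' M : Set (OnePoint ℂ))ᶜ x) ∧ OnePoint.infty ∉ H

/-- `M` has no holes. -/
def HasNoHoles (M : Set ℂ) : Prop := ∀ H, ¬ IsHole M H

/-- `S` is comeager: it contains a dense `G_δ`-set. -/
def IsComeager {X : Type*} [TopologicalSpace X] (S : Set X) : Prop :=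
  ∃ T ⊆ S, IsGδ T ∧ Dense T

/-- `{g ∘ f^n|_M : n = 1, 2, …}` as a subset of `C(M, ℂ)`, for `g` defined on `Ω`. -/
def compOrbit (f : ℂ → ℂ) (M : Set ℂ) {Ω : Set ℂ} (g : C(Ω, ℂ)) : Set C(M, ℂ) :=
  {u | ∃ n : ℕ, 1 ≤ n ∧ ∃ h : MapsTo f^[n] M Ω, ∀ z : M, u z = g ⟨f^[n] z, h z.2⟩}

/-- `g ∈ H(Ω)` is `F`-universal for `C_f`, where `F ⊆ C(M, ℂ)`: the closure in `C(M, ℂ)` of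
`{g ∘ f^n|_M : n = 1, 2, …}` contains `F`. -/
def IsUniversalFor (f : ℂ → ℂ) {M : Set ℂ} (F : Set C(M, ℂ)) {Ω : Set ℂ} (g : Hol Ω) : Prop :=
  F ⊆ closure (compOrbit f M (g : C(Ω, ℂ)))

/-- `z₀` is an attracting (and not superattracting) fixed point of `f`, which is holomorphic
near `z₀`. -/
structure IsAttractingFixedPoint (f : ℂ → ℂ) (z₀ : ℂ) : Prop where
  analyticAt : AnalyticAt ℂ f z₀
  isFixedPt : f z₀ = z₀
  multiplier_ne_zero : 0 < ‖deriv f z₀‖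
  multiplier_lt_one : ‖deriv f z₀‖ < 1

/-- `U` and `V` are open neighbourhoods of `z₀` and `0`, and `φ : U → V` is a conformal
(bijective holomorphic) map which conjugates the holomorphic self-map `f|_U : U → U` to
`w ↦ f'(z₀) w` on `V`. -/
structure IsKoenigsLinearization (f : ℂ → ℂ) (z₀ : ℂ) (U V : Set ℂ) (φ : ℂ → ℂ) : Prop where
  isOpen_source : IsOpen U
  mem_source : z₀ ∈ U
  isOpen_target : IsOpen V
  zero_mem_target : (0 : ℂ) ∈ V
  differentiableOn_symbol : DifferentiableOn ℂ f U
  mapsTo_symbol : MapsTo f U U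
  differentiableOn : DifferentiableOn ℂ φ U
  bijOn : BijOn φ U V
  conj : ∀ z ∈ U, φ (f z) = deriv f z₀ * φ z

/-! The proof is a Baire category argument. In `H(ℂ ∖ {z₀})`, which is a Baire space
(`baireSpace_hol`), universality follows from countably many conditions: on a finite union `L` of
closed balls, some `g ∘ f^n` lies in a given basic open set of `C(L, ℂ)`. Each condition is open
(`isOpen_visiting`); the work lies in its density (`dense_visiting`).

Density comes from `exists_polynomial_approx`. In the Koenigs coordinate `f` is multiplication by
`λ`, so every `f^n` is injective on `U` and `f^n → z₀` uniformly on compact sets. Given a compact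
`K` avoiding `z₀`, a large `n` moves the filled-in `L` much closer to `z₀` than `K` is. Under `w = 1
/ (z - z₀)`, `K` lands in a disc and the image of `L` outside a larger disc. Runge's theorem
(`exists_polynomial_norm_sub_lt`) gives a polynomial in `w` that is nearly `0` on the disc and
nearly the required correction on the image of `L`. Adding it to `g` hardly changes `g` on `K`.

Runge with polynomials needs the image of `L` to acquire no holes under the injective map `ψ = 1 /
(f^n - z₀)`. This is handled by continuous logarithms: `b` lies outside the filled-in `L` when `z -
b` has a logarithm on `L`. Zero-free holomorphic functions near the hull then have logarithms on `L`
(`hasLogOn_of_differentiableOn`). Applied to `ψ - b` and transported by `ψ⁻¹`, this is the condition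
needed on the image. The no-holes hypothesis on `W` enters only through
`logHull_subset_of_hasNoHoles`. -/

/-! ### Continuous logarithms and hulls of compact sets -/

/-- `F` has a continuous logarithm on `K`. -/
def HasLogOn (K : Set ℂ) (F : ℂ → ℂ) : Prop :=
  ∃ G : ℂ → ℂ, ContinuousOn G K ∧ ∀ z ∈ K, Complex.exp (G z) = F z

namespace HasLogOn

variable {K L : Set ℂ} {F F₁ F₂ : ℂ → ℂ}

theorem congr (h : HasLogOn K F₁) (h' : EqOn F₁ F₂ K) : HasLogOn K F₂ := by
  obtain ⟨G, hG, hE⟩ := h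
  exact ⟨G, hG, fun z hz => (hE z hz).trans (h' hz)⟩

theorem mono (h : HasLogOn L F) (hKL : K ⊆ L) : HasLogOn K F := by
  obtain ⟨G, hG, hE⟩ := h
  exact ⟨G, hG.mono hKL, fun z hz => hE z (hKL hz)⟩

theorem ne_zero (h : HasLogOn K F) {z : ℂ} (hz : z ∈ K) : F z ≠ 0 := by
  obtain ⟨G, -, hE⟩ := h
  exact hE z hz ▸ Complex.exp_ne_zero _

theorem mul (h₁ : HasLogOn K F₁) (h₂ : HasLogOn K F₂) : HasLogOn K (fun z => F₁ z * F₂ z) := by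
  obtain ⟨G₁, hG₁, hE₁⟩ := h₁
  obtain ⟨G₂, hG₂, hE₂⟩ := h₂
  exact ⟨fun z => G₁ z + G₂ z, hG₁.add hG₂, fun z hz => by
    rw [Complex.exp_add, hE₁ z hz, hE₂ z hz]⟩

theorem inv (h : HasLogOn K F) : HasLogOn K (fun z => (F z)⁻¹) := by
  obtain ⟨G, hG, hE⟩ := h
  exact ⟨fun z => -G z, hG.neg, fun z hz => by rw [Complex.exp_neg, hE z hz]⟩

theorem const {c : ℂ} (hc : c ≠ 0) : HasLogOn K (fun _ => c) :=
  ⟨fun _ => Complex.log c, continuousOn_const, fun _ _ => Complex.exp_log hc⟩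

theorem multiset_prod {s : Multiset ℂ} (h : ∀ b ∈ s, HasLogOn K (fun z => z - b)) :
    HasLogOn K (fun z => (s.map fun b => z - b).prod) := by
  induction s using Multiset.induction_on with
  | empty => simpa using const (K := K) one_ne_zero
  | cons a s ih =>
    simp only [Multiset.map_cons, Multiset.prod_cons]
    exact (h a (Multiset.mem_cons_self a s)).mul
      (ih fun b hb => h b (Multiset.mem_cons_of_mem hb))

theorem comp {h : ℂ → ℂ} (hF : HasLogOn (h '' K) F) (hh : ContinuousOn h K) :
    HasLogOn K (fun z => F (h z)) := by
  obtain ⟨G, hG, hE⟩ := hF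
  exact ⟨fun z => G (h z), hG.comp hh (mapsTo_image h K), fun z hz => hE _ (mem_image_of_mem h hz)⟩

theorem of_norm_sub_one_lt (hF : ContinuousOn F K) (h : ∀ z ∈ K, ‖F z - 1‖ < 1) :
    HasLogOn K F := by
  have hs : ∀ z ∈ K, F z ∈ Complex.slitPlane := fun z hz => by
    simpa using Complex.mem_slitPlane_of_norm_lt_one (h z hz)
  exact ⟨fun z => Complex.log (F z), hF.clog hs, fun z hz =>
    Complex.exp_log (Complex.slitPlane_ne_zero (hs z hz))⟩

/-- Logarithms persist under perturbations that are small relative to the function. -/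
theorem of_norm_sub_lt (h₁ : HasLogOn K F₁) (hF₁ : ContinuousOn F₁ K) (hF₂ : ContinuousOn F₂ K)
    (h : ∀ z ∈ K, ‖F₂ z - F₁ z‖ < ‖F₁ z‖) : HasLogOn K F₂ := by
  have hq : HasLogOn K (fun z => F₂ z / F₁ z) := by
    refine of_norm_sub_one_lt (hF₂.div hF₁ fun z hz => h₁.ne_zero hz) fun z hz => ?_
    have h0 := h₁.ne_zero hz
    rw [div_sub_one h0, norm_div, div_lt_one (norm_pos_iff.2 h0)]
    exact h z hz
  refine (h₁.mul hq).congr fun z hz => ?_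
  exact mul_div_cancel₀ _ (h₁.ne_zero hz)

theorem sub_of_norm_lt {b : ℂ} (h : ∀ z ∈ K, ‖z‖ < ‖b‖) : HasLogOn K (fun z => z - b) := by
  rcases K.eq_empty_or_nonempty with rfl | ⟨z, hz⟩
  · exact ⟨fun _ => 0, continuousOn_empty _, by simp⟩
  have hb : -b ≠ 0 := neg_ne_zero.2 (norm_pos_iff.1 ((norm_nonneg z).trans_lt (h z hz)))
  refine (const hb).of_norm_sub_lt continuousOn_const (by fun_prop) fun z hz => ?_
  simpa using h z hz

theorem union (hK : IsClosed K) (hL : IsClosed L) (hd : Disjoint K L) (h₁ : HasLogOn K F)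
    (h₂ : HasLogOn L F) : HasLogOn (K ∪ L) F := by
  classical
  obtain ⟨G₁, hG₁, hE₁⟩ := h₁
  obtain ⟨G₂, hG₂, hE₂⟩ := h₂
  have e₁ : EqOn (K.piecewise G₁ G₂) G₁ K := piecewise_eqOn _ _ _
  have e₂ : EqOn (K.piecewise G₁ G₂) G₂ L := fun z hz =>
    piecewise_eq_of_notMem _ _ _ (hd.notMem_of_mem_right hz)
  refine ⟨K.piecewise G₁ G₂, ?_, ?_⟩
  · exact (hG₁.congr e₁).union_of_isClosed (hG₂.congr e₂) hK hL
  · rintro z (hz | hz)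
    · rw [e₁ hz, hE₁ z hz]
    · rw [e₂ hz, hE₂ z hz]

end HasLogOn

/-- Along the circle, `(G - it - log R) / 2πi` is continuous and integer-valued, hence constant; but
over one turn `G` returns to its value while `t` grows by `2π`. -/
theorem not_hasLogOn_sphere {b : ℂ} {R : ℝ} (hR : 0 < R) :
    ¬ HasLogOn (Metric.sphere b R) (fun z => z - b) := by
  rintro ⟨G, hG, hE⟩
  have hmem : ∀ t : ℝ, circleMap b R t ∈ Metric.sphere b R := circleMap_mem_sphere b hR.le
  set k : ℝ → ℂ := fun t => (G (circleMap b R t) - t * Complex.I - Real.log R) /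
    (2 * Real.pi * Complex.I) with hk
  have hkc : Continuous k := by
    have : Continuous fun t => G (circleMap b R t) :=
      hG.comp_continuous (continuous_circleMap b R) hmem
    exact ((this.sub (by fun_prop)).sub continuous_const).div_const _
  have hint : ∀ t, ∃ n : ℤ, k t = n := by
    intro t
    have h1 : Complex.exp (G (circleMap b R t)) = Complex.exp (Real.log R + t * Complex.I) := by
      rw [hE _ (hmem t), Complex.exp_add, ← Complex.ofReal_exp, Real.exp_log hR]
      simp [circleMap]
    obtain ⟨n, hn⟩ := Complex.exp_eq_exp_iff_exists_int.1 h1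
    refine ⟨n, ?_⟩
    rw [hk]
    simp only
    rw [div_eq_iff Complex.two_pi_I_ne_zero, hn]
    ring
  choose n hn using hint
  have hnc : Continuous n := by
    have : Continuous fun t => ((n t : ℤ) : ℝ) := by
      have : (fun t => ((n t : ℤ) : ℝ)) = fun t => (k t).re := by
        ext t; rw [hn]; simp
      rw [this]; fun_prop
    exact Int.isClosedEmbedding_coe_real.isEmbedding.continuous_iff.2 this
  have hconst : n 0 = n (2 * Real.pi) :=
    PreconnectedSpace.constant inferInstance hnc
  have : k 0 = k (2 * Real.pi) := by rw [hn, hn, hconst]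
  simp only [hk] at this
  rw [div_left_inj' Complex.two_pi_I_ne_zero] at this
  have hper : circleMap b R (2 * Real.pi) = circleMap b R 0 := by
    simpa using periodic_circleMap b R 0
  rw [hper] at this
  have h2 : (2 * Real.pi * Complex.I : ℂ) = 0 := by
    push_cast at this
    linear_combination this
  exact Complex.two_pi_I_ne_zero h2

/-- The exponential covers `ℂ ∖ {0}` and the plane is simply connected, so `F` lifts. -/
theorem hasLogOn_univ {F : ℂ → ℂ} (hF : Continuous F) (h0 : ∀ z, F z ≠ 0) : HasLogOn univ F := by
  obtain ⟨G, ⟨-, hG⟩, -⟩ := Complex.isCoveringMapOn_exp.existsUnique_continuousMap_lifts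
    (⟨F, hF⟩ : C(ℂ, ℂ)) (Complex.exp_log (h0 0)) h0
  exact ⟨G, G.continuous.continuousOn, fun z _ => congrFun hG z⟩

/-- If `z - b` has a continuous logarithm on the closed set `K`, then the component of `b` in the
complement of `K` is unbounded. -/
theorem HasLogOn.not_isBounded_connectedComponentIn {K : Set ℂ} (hK : IsClosed K) {b : ℂ}
    (h : HasLogOn K (fun z => z - b)) : ¬ Bornology.IsBounded (connectedComponentIn Kᶜ b) := by
  classical
  intro hbd
  have hbK : b ∈ Kᶜ := fun hb => h.ne_zero hb (sub_self b)
  obtain ⟨G, hG, hE⟩ := h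
  -- Tietze: the logarithm extends continuously from `K` to the whole plane.
  obtain ⟨g, hg⟩ := ContinuousMap.exists_restrict_eq hK
    ⟨K.domRestrict G, continuousOn_iff_continuous_domRestrict.1 hG⟩
  have hgG : ∀ z ∈ K, g z = G z := fun z hz => congrArg (fun u : C(K, ℂ) => u ⟨z, hz⟩) hg
  set O := connectedComponentIn Kᶜ b with hO
  have hOo : IsOpen O := hK.isOpen_compl.connectedComponentIn
  have hbO : b ∈ O := mem_connectedComponentIn hbK
  have hfr : frontier O ⊆ K := by
    intro z hz
    by_contra hzK
    have hzc : z ∈ closure O := frontier_subset_closure hz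
    have h1 : IsPreconnected (insert z O) :=
      isPreconnected_connectedComponentIn.subset_closure (subset_insert _ _)
        (insert_subset hzc subset_closure)
    have h2 : insert z O ⊆ O := h1.subset_connectedComponentIn (mem_insert_of_mem _ hbO)
      (insert_subset hzK (connectedComponentIn_subset _ _))
    rw [hOo.frontier_eq] at hz
    exact hz.2 (h2 (mem_insert _ _))
  -- The pieces agree on `frontier O ⊆ K`. The glued function has no zeros, because `b ∈ O`, so it
  -- has a global logarithm; yet it equals `z - b` on a circle enclosing `O`.
  set F : ℂ → ℂ := O.piecewise (fun z => Complex.exp (g z)) (fun z => z - b) with hF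
  have hFc : Continuous F := by
    refine continuous_piecewise ?_ ?_ ?_
    · intro z hz
      rw [hgG z (hfr hz), hE z (hfr hz)]
    · exact (Complex.continuous_exp.comp g.continuous).continuousOn
    · exact (continuous_id.sub continuous_const).continuousOn
  have hF0 : ∀ z, F z ≠ 0 := by
    intro z
    by_cases hz : z ∈ O
    · rw [hF, piecewise_eq_of_mem _ _ _ hz]; exact Complex.exp_ne_zero _
    · rw [hF, piecewise_eq_of_notMem _ _ _ hz, sub_ne_zero]
      rintro rfl; exact hz hbO
  obtain ⟨R, hR⟩ := hbd.subset_ball b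
  have hRpos : 0 < R := Metric.pos_of_mem_ball (hR hbO)
  refine not_hasLogOn_sphere (b := b) hRpos
    (((hasLogOn_univ hFc hF0).mono (subset_univ _)).congr ?_)
  intro z hz
  rw [hF]
  refine piecewise_eq_of_notMem _ _ _ fun hzO => ?_
  have := hR hzO
  rw [Metric.mem_ball] at this
  rw [Metric.mem_sphere] at hz
  exact this.ne hz

/-- The points `b` for which `z - b` has no continuous logarithm on `K`; for compact `K` this is
`K` with its holes filled in. -/
def logHull (K : Set ℂ) : Set ℂ := {b | ¬ HasLogOn K (fun z => z - b)}

theorem notMem_logHull {K : Set ℂ} {b : ℂ} : b ∉ logHull K ↔ HasLogOn K (fun z => z - b) :=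
  not_not

theorem subset_logHull (K : Set ℂ) : K ⊆ logHull K := fun _ hb h => h.ne_zero hb (sub_self _)

/-- Moving `b` to `c` perturbs `z - b` by less than its modulus. Both the compactness of the hull
and the openness of its holes rest on this. -/
theorem HasLogOn.sub_of_dist_lt {K : Set ℂ} {b c : ℂ} (h : HasLogOn K (fun z => z - b))
    (hc : ∀ z ∈ K, dist c b < dist z b) : HasLogOn K (fun z => z - c) := by
  refine h.of_norm_sub_lt (by fun_prop) (by fun_prop) fun z hz => ?_
  have := hc z hz
  rw [dist_eq_norm, dist_eq_norm] at this
  rwa [sub_sub_sub_cancel_left, norm_sub_rev]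

theorem isCompact_logHull {K : Set ℂ} (hK : IsCompact K) : IsCompact (logHull K) := by
  refine Metric.isCompact_of_isClosed_isBounded ?_ ?_
  · rw [← isOpen_compl_iff, Metric.isOpen_iff]
    intro b hb
    have hb' : HasLogOn K (fun z => z - b) := notMem_logHull.1 hb
    have hbK : b ∈ Kᶜ := fun h => hb (subset_logHull K h)
    obtain ⟨ε, hε, hball⟩ := Metric.isOpen_iff.1 hK.isClosed.isOpen_compl b hbK
    refine ⟨ε, hε, fun c hc => notMem_logHull.2 (hb'.sub_of_dist_lt fun z hz => ?_)⟩
    refine (Metric.mem_ball.1 hc).trans_le ?_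
    by_contra hlt
    exact hball (Metric.mem_ball.2 (not_le.1 hlt)) hz
  · obtain ⟨R, hR⟩ := hK.isBounded.exists_norm_le
    refine (Metric.isBounded_closedBall (x := (0 : ℂ)) (r := R)).subset fun b hb => ?_
    rw [mem_closedBall_zero_iff]
    by_contra hlt
    exact hb (HasLogOn.sub_of_norm_lt fun z hz => (hR z hz).trans_lt (not_le.1 hlt))

theorem isOpen_logHull_diff {K : Set ℂ} (hK : IsClosed K) : IsOpen (logHull K \ K) := by
  rw [Metric.isOpen_iff]
  rintro b ⟨hb, hbK⟩
  obtain ⟨ε, hε, hball⟩ := Metric.isOpen_iff.1 hK.isOpen_compl b hbK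
  -- With `ε / 2`, a nearby `c` is still farther from `K` than from `b`, so a logarithm for `c`
  -- could be moved back to `b`.
  refine ⟨ε / 2, half_pos hε, fun c hc => ⟨fun hlog => ?_, ?_⟩⟩
  · refine hb (hlog.sub_of_dist_lt fun z hz => ?_)
    have h1 : ε ≤ dist z b := by
      by_contra hlt
      exact hball (Metric.mem_ball.2 (not_le.1 hlt)) hz
    have h2 := dist_triangle z c b
    rw [Metric.mem_ball] at hc
    rw [dist_comm b c]
    linarith
  · exact hball (Metric.ball_subset_ball (half_le_self hε.le) hc)

/-- A set without holes contains the hulls of its compact subsets. -/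
theorem logHull_subset_of_hasNoHoles {K W : Set ℂ} (hK : IsCompact K) (hKW : K ⊆ W)
    (hW : HasNoHoles W) : logHull K ⊆ W := by
  intro x hx
  by_contra hxW
  have hxc : (x : OnePoint ℂ) ∈ ((↑) '' W : Set (OnePoint ℂ))ᶜ := by simpa using hxW
  set C := connectedComponentIn ((↑) '' W : Set (OnePoint ℂ))ᶜ (x : OnePoint ℂ) with hC
  have hinf : OnePoint.infty ∈ C := by
    by_contra h
    exact hW C ⟨⟨x, hxc, rfl⟩, h⟩
  -- The outside of the hull and the hull minus `K` are disjoint open sets of the sphere covering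
  -- `C`. Since `C` is connected and contains `∞`, it lies in the first, whereas `x` lies in the
  -- hull.
  have hA : IsOpen ((↑) '' (logHull K) : Set (OnePoint ℂ))ᶜ :=
    OnePoint.isOpen_compl_image_coe.2 ⟨(isCompact_logHull hK).isClosed, isCompact_logHull hK⟩
  have hD : IsOpen ((↑) '' (logHull K \ K) : Set (OnePoint ℂ)) :=
    OnePoint.isOpen_image_coe.2 (isOpen_logHull_diff hK.isClosed)
  have hdisj : Disjoint ((↑) '' (logHull K) : Set (OnePoint ℂ))ᶜ ((↑) '' (logHull K \ K)) :=
    disjoint_compl_left.mono_right (image_mono sdiff_subset)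
  have hcov : C ⊆ ((↑) '' (logHull K) : Set (OnePoint ℂ))ᶜ ∪ (↑) '' (logHull K \ K) := by
    intro y hy
    by_cases hyH : y ∈ ((↑) '' (logHull K) : Set (OnePoint ℂ))
    · obtain ⟨y', hy', rfl⟩ := hyH
      refine Or.inr ⟨y', ⟨hy', fun hyK => ?_⟩, rfl⟩
      exact connectedComponentIn_subset _ _ hy ⟨y', hKW hyK, rfl⟩
    · exact Or.inl hyH
  have hsub := (isPreconnected_connectedComponentIn : IsPreconnected C).subset_left_of_subset_union
    hA hD hdisj hcov ⟨OnePoint.infty, hinf, OnePoint.infty_notMem_image_coe⟩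
  exact hsub (mem_connectedComponentIn hxc) ⟨x, hx, rfl⟩

/-! ### The Cauchy-Pompeiu formula -/

section CauchyPompeiu

open MeasureTheory

theorem intervalIntegral_div_sq_add_sq {R : ℝ} (hR : 0 < R) :
    ∫ s in -R..R, (R : ℂ) / ((s : ℂ) ^ 2 + R ^ 2) = Real.pi / 2 := by
  have h1 : ∫ s in -R..R, R / (s ^ 2 + R ^ 2) = Real.pi / 2 := by
    have h2 : ∀ s : ℝ, R / (s ^ 2 + R ^ 2) = R⁻¹ * (1 + (s / R) ^ 2)⁻¹ := fun s => by
      have : s ^ 2 + R ^ 2 ≠ 0 := by positivity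
      field_simp
      ring
    simp_rw [h2]
    rw [intervalIntegral.integral_const_mul,
      intervalIntegral.integral_comp_div (fun x => (1 + x ^ 2)⁻¹) hR.ne', integral_inv_one_add_sq,
      neg_div, div_self hR.ne', Real.arctan_neg, Real.arctan_one, smul_eq_mul,
      inv_mul_cancel_left₀ hR.ne']
    ring
  have h3 := intervalIntegral.integral_ofReal (μ := volume) (a := -R) (b := R)
    (f := fun s => R / (s ^ 2 + R ^ 2))
  rw [h1] at h3
  push_cast at h3
  simpa using h3

/-- The integral of `1 / (ζ - z)` along the boundary of a square centred at `z`. -/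
theorem square_integral_inv {R : ℝ} (hR : 0 < R) (a b : ℝ) :
    (∫ x in (a - R)..(a + R), (((x : ℂ) + ↑(b - R) * Complex.I) - (a + b * Complex.I))⁻¹) -
      (∫ x in (a - R)..(a + R), (((x : ℂ) + ↑(b + R) * Complex.I) - (a + b * Complex.I))⁻¹) +
      Complex.I • (∫ y in (b - R)..(b + R),
        (((a + R : ℝ) + (y : ℂ) * Complex.I) - (a + b * Complex.I))⁻¹) -
      Complex.I • (∫ y in (b - R)..(b + R),
        (((a - R : ℝ) + (y : ℂ) * Complex.I) - (a + b * Complex.I))⁻¹) =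
      2 * Real.pi * Complex.I := by
  have shift : ∀ (g : ℝ → ℂ) (c : ℝ), ∫ x in (c - R)..(c + R), g (x - c) = ∫ s in -R..R, g s :=
    fun g c => by rw [intervalIntegral.integral_comp_sub_right]; congr 1 <;> ring
  have hpos : ∀ s : ℝ, (s : ℂ) ^ 2 + R ^ 2 ≠ 0 := fun s => by
    have : s ^ 2 + R ^ 2 ≠ 0 := by positivity
    exact_mod_cast this
  have hm : ∀ s : ℝ, (s : ℂ) - R * Complex.I ≠ 0 := fun s h => hpos s (by
    linear_combination (s + R * Complex.I) * h + R ^ 2 * Complex.I_sq)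
  have hp : ∀ s : ℝ, (s : ℂ) + R * Complex.I ≠ 0 := fun s h => hpos s (by
    linear_combination (s - R * Complex.I) * h + R ^ 2 * Complex.I_sq)
  have hm' : ∀ s : ℝ, (R : ℂ) - s * Complex.I ≠ 0 := fun s h => hpos s (by
    linear_combination (R + s * Complex.I) * h + s ^ 2 * Complex.I_sq)
  have hp' : ∀ s : ℝ, (R : ℂ) + s * Complex.I ≠ 0 := fun s h => hpos s (by
    linear_combination (R - s * Complex.I) * h + s ^ 2 * Complex.I_sq)
  have e1 : ∀ x : ℝ, (((x : ℂ) + ↑(b - R) * Complex.I) - (a + b * Complex.I))⁻¹ =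
      (fun s : ℝ => ((s : ℂ) - R * Complex.I)⁻¹) (x - a) := fun x => by
    push_cast; congr 1; ring
  have e2 : ∀ x : ℝ, (((x : ℂ) + ↑(b + R) * Complex.I) - (a + b * Complex.I))⁻¹ =
      (fun s : ℝ => ((s : ℂ) + R * Complex.I)⁻¹) (x - a) := fun x => by
    push_cast; congr 1; ring
  have e3 : ∀ y : ℝ, (((a + R : ℝ) + (y : ℂ) * Complex.I) - (a + b * Complex.I))⁻¹ =
      (fun s : ℝ => ((R : ℂ) + s * Complex.I)⁻¹) (y - b) := fun y => by
    push_cast; congr 1; ring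
  have e4 : ∀ y : ℝ, (((a - R : ℝ) + (y : ℂ) * Complex.I) - (a + b * Complex.I))⁻¹ =
      (fun s : ℝ => -((R : ℂ) - s * Complex.I)⁻¹) (y - b) := fun y => by
    push_cast; rw [← inv_neg]; congr 1; ring
  rw [(intervalIntegral.integral_congr fun x _ => e1 x).trans
      (shift (fun s : ℝ => ((s : ℂ) - R * Complex.I)⁻¹) a),
    (intervalIntegral.integral_congr fun x _ => e2 x).trans
      (shift (fun s : ℝ => ((s : ℂ) + R * Complex.I)⁻¹) a),
    (intervalIntegral.integral_congr fun y _ => e3 y).trans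
      (shift (fun s : ℝ => ((R : ℂ) + s * Complex.I)⁻¹) b),
    (intervalIntegral.integral_congr fun y _ => e4 y).trans
      (shift (fun s : ℝ => -((R : ℂ) - s * Complex.I)⁻¹) b)]
  have i1 : IntervalIntegrable (fun s : ℝ => ((s : ℂ) - R * Complex.I)⁻¹) volume (-R) R :=
    (Continuous.inv₀ (by fun_prop) hm).intervalIntegrable _ _
  have i2 : IntervalIntegrable (fun s : ℝ => ((s : ℂ) + R * Complex.I)⁻¹) volume (-R) R :=
    (Continuous.inv₀ (by fun_prop) hp).intervalIntegrable _ _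
  have i3 : IntervalIntegrable (fun s : ℝ => ((R : ℂ) + s * Complex.I)⁻¹) volume (-R) R :=
    (Continuous.inv₀ (by fun_prop) hp').intervalIntegrable _ _
  have i4 : IntervalIntegrable (fun s : ℝ => -((R : ℂ) - s * Complex.I)⁻¹) volume (-R) R :=
    (Continuous.inv₀ (by fun_prop) hm').neg.intervalIntegrable _ _
  rw [add_sub_assoc, ← smul_sub, ← intervalIntegral.integral_sub i1 i2,
    ← intervalIntegral.integral_sub i3 i4]
  have f1 : ∀ s : ℝ, ((s : ℂ) - R * Complex.I)⁻¹ - ((s : ℂ) + R * Complex.I)⁻¹ =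
      2 * Complex.I * (R / ((s : ℂ) ^ 2 + R ^ 2)) := fun s => by
    have h1 := hm s
    have h2 := hp s
    have h3 := hpos s
    have h4 : (s : ℂ) ^ 2 + R ^ 2 = (s - R * Complex.I) * (s + R * Complex.I) := by
      linear_combination R ^ 2 * Complex.I_sq
    rw [h4]
    field_simp
    ring
  have f2 : ∀ s : ℝ, ((R : ℂ) + s * Complex.I)⁻¹ - -((R : ℂ) - s * Complex.I)⁻¹ =
      2 * (R / ((s : ℂ) ^ 2 + R ^ 2)) := fun s => by
    have h1 := hm' s
    have h2 := hp' s
    have h4 : (s : ℂ) ^ 2 + R ^ 2 = (R - s * Complex.I) * (R + s * Complex.I) := by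
      linear_combination s ^ 2 * Complex.I_sq
    rw [h4]
    field_simp
    ring
  simp_rw [f1, f2]
  rw [intervalIntegral.integral_const_mul, intervalIntegral.integral_const_mul,
    intervalIntegral_div_sq_add_sq hR, smul_eq_mul]
  ring

/-- A holomorphic function near a compact set agrees there with a compactly supported `C¹`
function. -/
theorem exists_contDiff_eq_nhdsSet {K N : Set ℂ} (hK : IsCompact K) (hN : IsOpen N) (hKN : K ⊆ N)
    {F : ℂ → ℂ} (hF : DifferentiableOn ℂ F N) :
    ∃ u : ℂ → ℂ, ContDiff ℝ 1 u ∧ HasCompactSupport u ∧ ∀ᶠ z in 𝓝ˢ K, u z = F z := by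
  obtain ⟨t, ht, hKt, htN⟩ := exists_compact_between hK hN hKN
  obtain ⟨χ, hχ1, hχ0, -⟩ := exists_contMDiffMap_one_nhds_of_subset_interior
    (modelWithCornersSelf ℝ ℂ) (n := 1) hK.isClosed hKt
  have hχ : ContDiff ℝ 1 χ := χ.contMDiff.contDiff
  refine ⟨fun z => χ z • F z, ?_, ?_, ?_⟩
  · rw [contDiff_iff_contDiffAt]
    intro z
    by_cases hz : z ∈ N
    · have h1 : ContDiffAt ℂ 1 F z := (hF.analyticAt (hN.mem_nhds hz)).contDiffAt
      exact hχ.contDiffAt.smul (h1.restrict_scalars ℝ)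
    · have h0 : (fun z => χ z • F z) =ᶠ[𝓝 z] fun _ => 0 := by
        filter_upwards [ht.isClosed.isOpen_compl.mem_nhds fun h => hz (htN h)] with w hw
        rw [hχ0 w hw, zero_smul]
      exact contDiffAt_const.congr_of_eventuallyEq h0
  · refine HasCompactSupport.intro ht fun z hz => ?_
    rw [hχ0 z hz, zero_smul]
  · filter_upwards [hχ1] with z hz
    rw [hz, one_smul]

/-- `2i` times the `∂̄`-derivative. -/
noncomputable def dbarI (u : ℂ → ℂ) (z : ℂ) : ℂ :=
  Complex.I * fderiv ℝ u z 1 - fderiv ℝ u z Complex.I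

theorem ContDiff.continuous_dbarI {u : ℂ → ℂ} (hu : ContDiff ℝ 1 u) : Continuous (dbarI u) := by
  have h := hu.continuous_fderiv one_ne_zero
  unfold dbarI
  fun_prop

theorem dbarI_eq_zero {u : ℂ → ℂ} {z : ℂ} (hu : DifferentiableAt ℂ u z) : dbarI u z = 0 := by
  rw [dbarI, hu.fderiv_restrictScalars ℝ]
  simp only [ContinuousLinearMap.coe_restrictScalars']
  rw [show fderiv ℂ u z Complex.I = Complex.I • fderiv ℂ u z 1 by
    rw [← map_smul, smul_eq_mul, mul_one], smul_eq_mul, sub_self]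

theorem dbarI_eq_zero_of_notMem_tsupport {u : ℂ → ℂ} {z : ℂ} (hz : z ∉ tsupport u) :
    dbarI u z = 0 := by
  rw [dbarI, image_eq_zero_of_notMem_tsupport fun h => hz (tsupport_fderiv_subset ℝ h)]
  simp

/-- A continuous function vanishing near `z` may be divided by `ζ - z`. -/
theorem continuous_div_sub {v : ℂ → ℂ} (hv : Continuous v) {z : ℂ} (hz : ∀ᶠ ζ in 𝓝 z, v ζ = 0) :
    Continuous fun ζ => v ζ / (ζ - z) := by
  rw [continuous_iff_continuousAt]
  intro ζ
  by_cases h : ζ = z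
  · subst h
    have : (fun ξ => v ξ / (ξ - ζ)) =ᶠ[𝓝 ζ] fun _ => 0 := by
      filter_upwards [hz] with ξ hξ
      rw [hξ, zero_div]
    exact continuousAt_const.congr this.symm
  · exact hv.continuousAt.div (by fun_prop) (sub_ne_zero.2 h)

theorem intervalIntegral_intervalIntegral_eq_integral {g : ℝ × ℝ → ℂ} (hg : Continuous g)
    (hc : HasCompactSupport g) {a b c d : ℝ}
    (hs : ∀ p, g p ≠ 0 → p ∈ Ioc a b ×ˢ Ioc c d) :
    ∫ x in a..b, ∫ y in c..d, g (x, y) = ∫ p, g p := by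
  have h1 : ∀ x, ∫ y in c..d, g (x, y) = ∫ y, g (x, y) := fun x =>
    intervalIntegral.integral_eq_integral_of_support_subset fun y hy => (hs (x, y) hy).2
  simp_rw [h1]
  rw [intervalIntegral.integral_eq_integral_of_support_subset, Measure.volume_eq_prod,
    integral_prod _ (by
      rw [← Measure.volume_eq_prod]
      exact hg.integrable_of_hasCompactSupport hc)]
  intro x hx
  by_contra hx'
  refine hx ?_
  have : ∀ y, g (x, y) = 0 := fun y => by
    by_contra hy
    exact hx' (hs (x, y) hy).1
  simp [this]

/-- The Cauchy-Pompeiu formula for a compactly supported `C¹` function at a point near which it is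
holomorphic. -/
theorem cauchy_pompeiu {u : ℂ → ℂ} (hu : ContDiff ℝ 1 u) (hc : HasCompactSupport u) {z : ℂ}
    (hz : ∀ᶠ ζ in 𝓝 z, DifferentiableAt ℂ u ζ) :
    -(2 * Real.pi * Complex.I) * u z =
      ∫ p : ℝ × ℝ, dbarI u (p.1 + p.2 * Complex.I) / (p.1 + p.2 * Complex.I - z) := by
  obtain ⟨R, hR, hsub⟩ : ∃ R : ℝ, 0 < R ∧ tsupport u ⊆ Metric.ball z R := by
    obtain ⟨R, hR⟩ := hc.isCompact.isBounded.subset_ball z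
    exact ⟨max R 1, by positivity, hR.trans (Metric.ball_subset_ball (le_max_left _ _))⟩
  have hdv : ∀ᶠ ζ in 𝓝 z, dbarI u ζ = 0 := hz.mono fun ζ hζ => dbarI_eq_zero hζ
  have hvc : Continuous fun ζ => dbarI u ζ / (ζ - z) := continuous_div_sub hu.continuous_dbarI hdv
  set e : ℝ × ℝ → ℂ := fun p => p.1 + p.2 * Complex.I with he
  have hec : Continuous e := by fun_prop
  set a := z.re with ha
  set b := z.im with hb
  have hzab : z = a + b * Complex.I := (Complex.re_add_im z).symm
  have hball : ∀ x y : ℝ, (x + y * Complex.I : ℂ) ∈ Metric.ball z R →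
      x ∈ Ioo (a - R) (a + R) ∧ y ∈ Ioo (b - R) (b + R) := by
    intro x y h
    rw [Metric.mem_ball, dist_eq_norm] at h
    have h1 := (Complex.abs_re_le_norm _).trans_lt h
    have h2 := (Complex.abs_im_le_norm _).trans_lt h
    simp only [Complex.sub_re, Complex.sub_im, Complex.add_re, Complex.add_im, Complex.ofReal_re,
      Complex.ofReal_im, Complex.mul_re, Complex.mul_im, Complex.I_re, Complex.I_im] at h1 h2
    rw [abs_lt] at h1 h2
    constructor <;> constructor <;> simp only [ha, hb] <;> linarith
  -- The difference quotient is continuous even at `z`, and away from `z` its `dbarI` is `dbarI u ζ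
  -- / (ζ - z)`. Green's formula on a square therefore applies with exceptional set `{z}`.
  set g := dslope u z with hg
  have hdiff : DifferentiableAt ℂ u z := hz.self_of_nhds
  have hgc : Continuous g := by
    rw [continuous_iff_continuousAt]
    intro ζ
    by_cases h : ζ = z
    · subst h
      exact continuousAt_dslope_same.2 hdiff
    · exact (continuousAt_dslope_of_ne h).2 hu.continuous.continuousAt
  have hgne : ∀ ζ, ζ ≠ z → g ζ = (u ζ - u z) * (ζ - z)⁻¹ := fun ζ h => by
    rw [hg, dslope_of_ne _ h, slope_def_field, div_eq_mul_inv]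
  set g' : ℂ → ℂ →L[ℝ] ℂ := fun ζ => (u ζ - u z) • ((-((ζ - z) ^ 2)⁻¹ : ℂ) •
      (ContinuousLinearMap.id ℝ ℂ)) + (ζ - z)⁻¹ • fderiv ℝ u ζ with hg'
  have hder : ∀ ζ, ζ ≠ z → HasFDerivAt g (g' ζ) ζ := by
    intro ζ h
    have h0 := sub_ne_zero.2 h
    have h1 : HasFDerivAt (fun ζ => u ζ - u z) (fderiv ℝ u ζ) ζ :=
      ((hu.differentiable one_ne_zero ζ).hasFDerivAt).sub_const _
    have h2 : HasFDerivAt (fun ζ : ℂ => (ζ - z)⁻¹)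
        ((-((ζ - z) ^ 2)⁻¹ : ℂ) • (ContinuousLinearMap.id ℝ ℂ)) ζ := by
      have h3 : HasDerivAt (fun ζ : ℂ => (ζ - z)⁻¹) (-((ζ - z) ^ 2)⁻¹) ζ := by
        have h4 := ((hasDerivAt_id ζ).sub_const z).inv h0
        rw [id, neg_div, one_div] at h4
        exact h4
      exact (h3.hasFDerivAt.restrictScalars ℝ).congr_fderiv (by
        ext x; simp [mul_comm])
    refine (h1.mul h2).congr_of_eventuallyEq ?_
    filter_upwards [isOpen_ne.mem_nhds h] with ξ hξ using hgne ξ hξ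
  have hdg : ∀ ζ, Complex.I • g' ζ 1 - g' ζ Complex.I = dbarI u ζ / (ζ - z) := by
    intro ζ
    simp only [hg', dbarI, add_apply, smul_apply,
      ContinuousLinearMap.id_apply, smul_eq_mul]
    ring
  have key := Complex.integral_boundary_rect_of_hasFDerivAt_real_off_countable g g'
    ⟨a - R, b - R⟩ ⟨a + R, b + R⟩ {z} (countable_singleton z) hgc.continuousOn
    (fun ζ hζ => hder ζ hζ.2) (by
      simp_rw [hdg]
      refine hvc.continuousOn.integrableOn_compact ?_
      exact IsCompact.reProdIm isCompact_uIcc isCompact_uIcc)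
  simp_rw [hdg] at key
  -- On the sides of the square `u` vanishes, so only `-u z / (ζ - z)` contributes to the boundary
  -- integral.
  have hside : ∀ x y : ℝ, (x = a - R ∨ x = a + R ∨ y = b - R ∨ y = b + R) →
      g (x + y * Complex.I) = -u z * ((x + y * Complex.I) - (a + b * Complex.I))⁻¹ := by
    intro x y h
    have hne : (x + y * Complex.I : ℂ) ∉ Metric.ball z R := fun hm => by
      have := hball x y hm
      rcases h with rfl | rfl | rfl | rfl <;> simp at this
    have hnz : (x + y * Complex.I : ℂ) ≠ z := fun h => hne (h ▸ Metric.mem_ball_self hR)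
    rw [hgne _ hnz, image_eq_zero_of_notMem_tsupport fun hm => hne (hsub hm), zero_sub, ← hzab]
  have s1 : ∀ x : ℝ, g (x + (b - R : ℝ) * Complex.I) = _ := fun x => hside x _ (by simp)
  have s2 : ∀ x : ℝ, g (x + (b + R : ℝ) * Complex.I) = _ := fun x => hside x _ (by simp)
  have s3 : ∀ y : ℝ, g ((a + R : ℝ) + y * Complex.I) = _ := fun y => hside _ y (by simp)
  have s4 : ∀ y : ℝ, g ((a - R : ℝ) + y * Complex.I) = _ := fun y => hside _ y (by simp)
  simp_rw [s1, s2, s3, s4, intervalIntegral.integral_const_mul] at key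
  have hsupp : ∀ p : ℝ × ℝ, dbarI u (p.1 + p.2 * Complex.I) / (p.1 + p.2 * Complex.I - z) ≠ 0 →
      (p.1 + p.2 * Complex.I : ℂ) ∈ tsupport u := fun p hp => by
    by_contra hm
    exact hp (by rw [dbarI_eq_zero_of_notMem_tsupport hm, zero_div])
  have hcs : HasCompactSupport fun p : ℝ × ℝ =>
      dbarI u (p.1 + p.2 * Complex.I) / (p.1 + p.2 * Complex.I - z) := by
    refine HasCompactSupport.intro
      ((isCompact_Icc (a := a - R) (b := a + R)).prod (isCompact_Icc (a := b - R) (b := b + R)))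
      fun p hp => ?_
    by_contra h
    have := hball _ _ (hsub (hsupp p h))
    exact hp ⟨Ioo_subset_Icc_self this.1, Ioo_subset_Icc_self this.2⟩
  have hint := intervalIntegral_intervalIntegral_eq_integral (a := a - R) (b := a + R)
    (c := b - R) (d := b + R) (hvc.comp hec) hcs (fun p hp => by
      have := hball _ _ (hsub (hsupp p hp))
      exact ⟨Ioo_subset_Ioc_self this.1, Ioo_subset_Ioc_self this.2⟩)
  simp only [Function.comp_def, he] at hint
  rw [← hint, ← key]
  have hsq := square_integral_inv hR a b
  simp only [smul_eq_mul] at hsq ⊢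
  linear_combination (u z) * hsq

end CauchyPompeiu

/-! ### Runge approximation and logarithms of zero-free functions -/

section Runge

open MeasureTheory

/-- A function holomorphic near the compact set `K` lies, as a function on `L ⊆ K`, in every closed
subspace of `C(L, ℂ)` which contains the functions `1 / (b - z)` with `b ∉ K`. -/
theorem mem_of_resolvents_mem {L K N : Set ℂ} (hL : IsCompact L) (hLK : L ⊆ K) (hK : IsCompact K)
    (hN : IsOpen N) (hKN : K ⊆ N) {F : ℂ → ℂ} (hF : DifferentiableOn ℂ F N)
    (S : Submodule ℂ C(L, ℂ)) (hS : IsClosed (S : Set C(L, ℂ)))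
    (hres : ∀ b ∉ K, ∀ r : C(L, ℂ), (∀ z : L, r z = (b - z)⁻¹) → r ∈ S)
    (φ : C(L, ℂ)) (hφ : ∀ z : L, φ z = F z) : φ ∈ S := by
  have : CompactSpace L := isCompact_iff_compactSpace.1 hL
  obtain ⟨u, hu, huc, huF⟩ := exists_contDiff_eq_nhdsSet hK hN hKN hF
  have hd : ∀ z ∈ K, ∀ᶠ ζ in 𝓝 z, DifferentiableAt ℂ u ζ := by
    intro z hz
    filter_upwards [(eventually_nhdsSet_iff_forall.1 huF z hz).eventually_nhds,
      hN.mem_nhds (hKN hz)] with ζ h1 h2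
    exact (hF.differentiableAt (hN.mem_nhds h2)).congr_of_eventuallyEq h1
  have hv0 : ∀ z ∈ K, ∀ᶠ ζ in 𝓝 z, dbarI u ζ = 0 := fun z hz =>
    (hd z hz).mono fun ζ hζ => dbarI_eq_zero hζ
  have hvc := hu.continuous_dbarI
  set e : ℝ × ℝ → ℂ := fun p => p.1 + p.2 * Complex.I with he
  have hec : Continuous e := by fun_prop
  have hjoint : Continuous fun q : (ℝ × ℝ) × L => dbarI u (e q.1) / (e q.1 - q.2) := by
    rw [continuous_iff_continuousAt]
    rintro ⟨p, z⟩
    by_cases h : e p = z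
    · have h0 : (fun q : (ℝ × ℝ) × L => dbarI u (e q.1) / (e q.1 - q.2)) =ᶠ[𝓝 (p, z)]
          fun _ => 0 := by
        have h1 : ContinuousAt (fun q : (ℝ × ℝ) × L => e q.1) (p, z) := by fun_prop
        have h2 := h1.eventually (hv0 (e p) (h ▸ hLK z.2))
        filter_upwards [h2] with q hq
        rw [hq, zero_div]
      exact continuousAt_const.congr h0.symm
    · refine ContinuousAt.div ?_ (by fun_prop) (sub_ne_zero.2 h)
      exact (hvc.comp (hec.comp continuous_fst)).continuousAt
  -- The Cauchy-Pompeiu integrand is read as a `C(L, ℂ)`-valued function: each value is a multiple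
  -- of a resolvent with pole off `K`, or zero.
  set Φ : C(ℝ × ℝ, C(L, ℂ)) := ContinuousMap.curry ⟨_, hjoint⟩ with hΦ
  have hΦa : ∀ p z, Φ p z = dbarI u (e p) / (e p - z) := fun p z => rfl
  have hΦS : ∀ p, Φ p ∈ S := by
    intro p
    by_cases h0 : dbarI u (e p) = 0
    · have : Φ p = 0 := by
        ext z
        rw [hΦa, h0, zero_div]; rfl
      rw [this]; exact S.zero_mem
    · have hpK : e p ∉ K := fun h => h0 (hv0 _ h).self_of_nhds
      have : (dbarI u (e p))⁻¹ • Φ p ∈ S := by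
        refine hres (e p) hpK _ fun z => ?_
        rw [ContinuousMap.smul_apply, hΦa, smul_eq_mul, div_eq_mul_inv, inv_mul_cancel_left₀ h0]
      exact (S.smul_mem_iff (inv_ne_zero h0)).1 this
  have hΦc : HasCompactSupport Φ := by
    refine HasCompactSupport.intro (huc.isCompact.image
      (f := fun z : ℂ => (z.re, z.im)) (by fun_prop)) fun p hp => ?_
    ext z
    have : e p ∉ tsupport u := fun h => hp ⟨e p, h, by simp [he]⟩
    rw [hΦa, dbarI_eq_zero_of_notMem_tsupport this, zero_div]; rfl
  have hΦi : Integrable Φ := Φ.continuous.integrable_of_hasCompactSupport hΦc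
  have hmem : ∫ p, Φ p ∈ S := by
    -- Integrating inside the complete space `S` keeps the integral in `S`.
    have : CompleteSpace S := hS.completeSpace_coe
    set Ψ : ℝ × ℝ → S := fun p => ⟨Φ p, hΦS p⟩ with hΨ
    have hΨi : Integrable Ψ := by
      refine Continuous.integrable_of_hasCompactSupport (Φ.continuous.subtype_mk _) ?_
      exact hΦc.mono fun p hp h => hp (Subtype.ext h)
    have := S.subtypeL.integral_comp_comm hΨi
    simp only [hΨ, Submodule.subtypeL_apply] at this
    rw [this]
    exact Subtype.prop _
  have hEq : φ = (-(2 * Real.pi * Complex.I))⁻¹ • ∫ p, Φ p := by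
    ext z
    have h1 := (ContinuousMap.evalCLM ℂ z : C(L, ℂ) →L[ℂ] ℂ).integral_comp_comm hΦi
    simp only [ContinuousMap.evalCLM_apply, hΦa] at h1
    rw [ContinuousMap.smul_apply, ← h1, ← cauchy_pompeiu hu huc (hd z (hLK z.2)), smul_eq_mul,
      inv_mul_cancel_left₀ (neg_ne_zero.2 Complex.two_pi_I_ne_zero), hφ,
      huF.self_of_nhdsSet z (hLK z.2)]
  rw [hEq]
  exact S.smul_mem _ hmem

/-- If `z - b` has a continuous logarithm on the compact set `L`, then `1 / (b - z)` is a uniform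
limit of polynomials on `L`. -/
theorem resolvent_mem_closure_polynomialFunctions {L : Set ℂ} [CompactSpace L] {b : ℂ}
    (hb : HasLogOn L (fun z => z - b)) {r : C(L, ℂ)} (hr : ∀ z : L, r z = (b - z)⁻¹) :
    r ∈ (polynomialFunctions L).topologicalClosure := by
  have hL : IsCompact L := isCompact_iff_compactSpace.2 inferInstance
  set A := (polynomialFunctions L).topologicalClosure with hA
  have hAc : IsClosed (A : Set C(L, ℂ)) := Subalgebra.isClosed_topologicalClosure _
  set X : C(L, ℂ) := Polynomial.toContinuousMapOn Polynomial.X L with hX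
  have hXA : X ∈ A := Subalgebra.le_topologicalClosure _ ⟨Polynomial.X, trivial, rfl⟩
  have hXz : ∀ z : L, X z = z := fun z => by simp [hX]
  have hspec : spectrum ℂ X = L := by
    rw [ContinuousMap.spectrum_eq_range]
    ext z
    constructor
    · rintro ⟨w, rfl⟩
      rw [hXz]; exact w.2
    · exact fun hz => ⟨⟨z, hz⟩, hXz _⟩
  -- Passing to a closed subalgebra can enlarge the spectrum only by bounded components of the
  -- complement, and the component of `b` is unbounded.
  have hnot : b ∉ spectrum ℂ (⟨X, hXA⟩ : A) := fun h => by
    have := Subalgebra.spectrum_isBounded_connectedComponentIn A (⟨X, hXA⟩ : A) h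
    rw [show spectrum ℂ (((⟨X, hXA⟩ : A)) : C(L, ℂ)) = L from hspec] at this
    exact hb.not_isBounded_connectedComponentIn hL.isClosed this
  obtain ⟨y, hy⟩ := (spectrum.notMem_iff.1 hnot).exists_right_inv
  have hry : r = y := by
    ext z
    have h1 := congrArg (fun t : A => (t : C(L, ℂ)) z) hy
    simp only [MulMemClass.coe_mul, AddSubgroupClass.coe_sub, ContinuousMap.mul_apply,
      ContinuousMap.sub_apply, hXz, OneMemClass.coe_one, ContinuousMap.one_apply] at h1
    have h2 : ((algebraMap ℂ A b : A) : C(L, ℂ)) z = b := rfl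
    rw [h2] at h1
    rw [hr]
    exact inv_eq_of_mul_eq_one_right h1
  rw [hry]
  exact y.2

/-- **Runge's theorem**: if `z - b` has a continuous logarithm on `L ⊆ K` for all `b ∉ K`, then
functions holomorphic near `K` are uniform limits of polynomials on `L`. -/
theorem exists_polynomial_norm_sub_lt {L K N : Set ℂ} (hL : IsCompact L) (hLK : L ⊆ K)
    (hK : IsCompact K) (hN : IsOpen N) (hKN : K ⊆ N) {F : ℂ → ℂ} (hF : DifferentiableOn ℂ F N)
    (hlog : ∀ b ∉ K, HasLogOn L (fun z => z - b)) {ε : ℝ} (hε : 0 < ε) :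
    ∃ p : Polynomial ℂ, ∀ z ∈ L, ‖p.eval z - F z‖ < ε := by
  have : CompactSpace L := isCompact_iff_compactSpace.1 hL
  set φ : C(L, ℂ) := ⟨L.domRestrict F,
    continuousOn_iff_continuous_domRestrict.1 (hF.continuousOn.mono (hLK.trans hKN))⟩ with hφ
  have hmem : φ ∈ (polynomialFunctions L).topologicalClosure :=
    mem_of_resolvents_mem hL hLK hK hN hKN hF
      (Subalgebra.toSubmodule (polynomialFunctions L).topologicalClosure)
      (Subalgebra.isClosed_topologicalClosure _)
      (fun b hb r hr => resolvent_mem_closure_polynomialFunctions (hlog b hb) hr) φ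
      fun z => rfl
  have hmem' : φ ∈ closure (polynomialFunctions L : Set C(L, ℂ)) := by
    rwa [← Subalgebra.topologicalClosure_coe]
  obtain ⟨_, ⟨p, -, rfl⟩, hp⟩ := Metric.mem_closure_iff.1 hmem' ε hε
  refine ⟨p, fun z hz => ?_⟩
  have h1 := (ContinuousMap.dist_apply_le_dist ⟨z, hz⟩).trans_lt hp
  rw [dist_comm, dist_eq_norm] at h1
  simpa [hφ] using h1

/-- All roots lie outside `K`, so the logarithms of the linear factors add up. -/
theorem hasLogOn_polynomial {L K : Set ℂ} (hLK : L ⊆ K)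
    (hlog : ∀ b ∉ K, HasLogOn L (fun z => z - b)) {p : Polynomial ℂ}
    (hp : ∀ z ∈ K, p.eval z ≠ 0) : HasLogOn L (fun z => p.eval z) := by
  rcases L.eq_empty_or_nonempty with rfl | ⟨z₀, hz₀⟩
  · exact ⟨fun _ => 0, continuousOn_empty _, by simp⟩
  have hp0 : p ≠ 0 := by
    rintro rfl
    exact hp z₀ (hLK hz₀) Polynomial.eval_zero
  have h1 : HasLogOn L (fun z => (p.roots.map fun b => z - b).prod) :=
    HasLogOn.multiset_prod fun b hb => hlog b fun hbK => hp b hbK (Polynomial.mem_roots hp0 |>.1 hb)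
  refine ((HasLogOn.const (Polynomial.leadingCoeff_ne_zero.2 hp0)).mul h1).congr fun z _ => ?_
  exact ((IsAlgClosed.splits p).eval_eq_prod_roots z).symm

/-- Functions in the algebra generated by the `1 / (b - z)`, `b ∉ K`, are rational without poles
in `K`. -/
theorem exists_rational_of_mem_adjoin {K : Set ℂ} {r : C(K, ℂ)}
    (hr : r ∈ Algebra.adjoin ℂ {s : C(K, ℂ) | ∃ b ∉ K, ∀ z : K, s z = (b - z)⁻¹}) :
    ∃ p q : Polynomial ℂ, ∀ z : K, q.eval (z : ℂ) ≠ 0 ∧ r z = p.eval (z : ℂ) / q.eval (z : ℂ) := by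
  induction hr using Algebra.adjoin_induction with
  | mem s hs =>
    obtain ⟨b, hb, h⟩ := hs
    refine ⟨1, Polynomial.C b - Polynomial.X, fun z => ⟨?_, ?_⟩⟩
    · simp only [Polynomial.eval_sub, Polynomial.eval_C, Polynomial.eval_X, sub_ne_zero]
      rintro rfl
      exact hb z.2
    · simp [h]
  | algebraMap c => exact ⟨Polynomial.C c, 1, fun z => by simp⟩
  | add s t _ _ hs ht =>
    obtain ⟨p, q, h⟩ := hs
    obtain ⟨p', q', h'⟩ := ht
    refine ⟨p * q' + q * p', q * q', fun z => ⟨?_, ?_⟩⟩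
    · simpa using ⟨(h z).1, (h' z).1⟩
    · rw [ContinuousMap.add_apply, (h z).2, (h' z).2, div_add_div _ _ (h z).1 (h' z).1]
      simp
  | mul s t _ _ hs ht =>
    obtain ⟨p, q, h⟩ := hs
    obtain ⟨p', q', h'⟩ := ht
    refine ⟨p * p', q * q', fun z => ⟨?_, ?_⟩⟩
    · simpa using ⟨(h z).1, (h' z).1⟩
    · rw [ContinuousMap.mul_apply, (h z).2, (h' z).2, div_mul_div_comm]
      simp

/-- If `z - b` has a continuous logarithm on `L ⊆ K` for all `b ∉ K`, then every function which is
holomorphic near `K` and has no zeros in `K` has a continuous logarithm on `L`. -/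
theorem hasLogOn_of_differentiableOn {L K N : Set ℂ} (hLK : L ⊆ K)
    (hK : IsCompact K) (hN : IsOpen N) (hKN : K ⊆ N) {F : ℂ → ℂ} (hF : DifferentiableOn ℂ F N)
    (hlog : ∀ b ∉ K, HasLogOn L (fun z => z - b)) (hF0 : ∀ z ∈ K, F z ≠ 0) : HasLogOn L F := by
  have : CompactSpace K := isCompact_iff_compactSpace.1 hK
  have hFc : ContinuousOn F K := hF.continuousOn.mono hKN
  obtain ⟨ε, hε, hεF⟩ : ∃ ε > 0, ∀ z ∈ K, ε ≤ ‖F z‖ := by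
    rcases K.eq_empty_or_nonempty with rfl | hne
    · exact ⟨1, one_pos, by simp⟩
    · obtain ⟨w, hw, hmin⟩ := hK.exists_isMinOn hne hFc.norm
      exact ⟨‖F w‖, norm_pos_iff.2 (hF0 w hw), fun z hz => hmin hz⟩
  set φ : C(K, ℂ) := ⟨K.domRestrict F, continuousOn_iff_continuous_domRestrict.1 hFc⟩ with hφ
  set A := Algebra.adjoin ℂ {s : C(K, ℂ) | ∃ b ∉ K, ∀ z : K, s z = (b - z)⁻¹} with hA
  have hmem : φ ∈ A.topologicalClosure :=
    mem_of_resolvents_mem hK subset_rfl hK hN hKN hF (Subalgebra.toSubmodule A.topologicalClosure)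
      (Subalgebra.isClosed_topologicalClosure _)
      (fun b hb r hr => Subalgebra.le_topologicalClosure A (Algebra.subset_adjoin ⟨b, hb, hr⟩)) φ
      fun z => rfl
  have hmem' : φ ∈ closure (A : Set C(K, ℂ)) := by
    rwa [← Subalgebra.topologicalClosure_coe]
  -- As `ε ≤ ‖F‖` on `K`, an error below `ε / 2` leaves the rational function larger than the error.
  -- It is thus zero-free on `K`, and its logarithm on `L` survives the perturbation to `F`.
  obtain ⟨r, hr, hd⟩ := Metric.mem_closure_iff.1 hmem' (ε / 2) (half_pos hε)
  obtain ⟨p, q, hpq⟩ := exists_rational_of_mem_adjoin hr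
  have hclose : ∀ z ∈ K, ‖F z - p.eval z / q.eval z‖ < ε / 2 := fun z hz => by
    have h1 := (ContinuousMap.dist_apply_le_dist (f := φ) (g := r) ⟨z, hz⟩).trans_lt hd
    rw [(hpq _).2, dist_eq_norm] at h1
    exact h1
  have hbig : ∀ z ∈ K, ε / 2 < ‖p.eval z / q.eval z‖ := fun z hz => by
    have h1 := hclose z hz
    have h2 := hεF z hz
    have h3 := norm_sub_norm_le (F z) (p.eval z / q.eval z)
    linarith
  have hq0 : ∀ z ∈ K, q.eval z ≠ 0 := fun z hz => (hpq ⟨z, hz⟩).1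
  have hp0 : ∀ z ∈ K, p.eval z ≠ 0 := fun z hz h => by
    have := hbig z hz
    rw [h, zero_div, norm_zero] at this
    linarith
  have h1 : HasLogOn L (fun z => p.eval z / q.eval z) := by
    simp_rw [div_eq_mul_inv]
    exact (hasLogOn_polynomial hLK hlog hp0).mul (hasLogOn_polynomial hLK hlog hq0).inv
  refine h1.of_norm_sub_lt ?_ (hFc.mono hLK) fun z hz => (hclose z (hLK hz)).trans (hbig z (hLK hz))
  exact p.continuous.continuousOn.div q.continuous.continuousOn fun z hz => hq0 z (hLK hz)

end Runge

/-! ### Injective holomorphic maps and their inverses -/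

section InverseFunction

variable {D : Set ℂ} {h : ℂ → ℂ}

theorem not_eventually_eq_of_injOn (hD : IsOpen D) (hi : InjOn h D) {x : ℂ} (hx : x ∈ D) :
    ¬ ∀ᶠ z in 𝓝 x, h z = h x := by
  intro hc
  have h1 : ∀ᶠ z in 𝓝[≠] x, z = x := by
    filter_upwards [mem_nhdsWithin_of_mem_nhds hc,
      mem_nhdsWithin_of_mem_nhds (hD.mem_nhds hx)] with z hz hzD using hi hzD hx hz
  obtain ⟨z, hz, hz'⟩ := (h1.and self_mem_nhdsWithin).exists
  exact hz' hz

theorem nhds_le_map_nhds_of_injOn (hD : IsOpen D) (hh : DifferentiableOn ℂ h D) (hi : InjOn h D)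
    {x : ℂ} (hx : x ∈ D) : 𝓝 (h x) ≤ Filter.map h (𝓝 x) :=
  ((hh.analyticAt (hD.mem_nhds hx)).eventually_constant_or_nhds_le_map_nhds).resolve_left
    (not_eventually_eq_of_injOn hD hi hx)

theorem isOpen_image_of_injOn (hD : IsOpen D) (hh : DifferentiableOn ℂ h D) (hi : InjOn h D) :
    IsOpen (h '' D) := by
  rw [isOpen_iff_mem_nhds]
  rintro _ ⟨x, hx, rfl⟩
  exact nhds_le_map_nhds_of_injOn hD hh hi hx (Filter.image_mem_map (hD.mem_nhds hx))

theorem continuousOn_invFunOn (hD : IsOpen D) (hh : DifferentiableOn ℂ h D) (hi : InjOn h D) :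
    ContinuousOn (invFunOn h D) (h '' D) := by
  rintro _ ⟨x, hx, rfl⟩
  refine ContinuousAt.continuousWithinAt ?_
  rw [ContinuousAt, hi.leftInvOn_invFunOn hx]
  refine (Filter.tendsto_map'_iff.2 ?_).mono_left (nhds_le_map_nhds_of_injOn hD hh hi hx)
  refine Filter.tendsto_id.congr' ?_
  filter_upwards [hD.mem_nhds hx] with z hz using (hi.leftInvOn_invFunOn hz).symm

/-- The inverse of an injective holomorphic function is holomorphic. -/
theorem differentiableOn_invFunOn (hD : IsOpen D) (hh : DifferentiableOn ℂ h D) (hi : InjOn h D) :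
    DifferentiableOn ℂ (invFunOn h D) (h '' D) := by
  have hO := isOpen_image_of_injOn hD hh hi
  have hc := continuousOn_invFunOn hD hh hi
  have hri : ∀ y ∈ h '' D, h (invFunOn h D y) = y := fun y hy => invFunOn_eq hy
  have hreg : ∀ y ∈ h '' D, deriv h (invFunOn h D y) ≠ 0 →
      DifferentiableAt ℂ (invFunOn h D) y := by
    intro y hy hd
    have hm : invFunOn h D y ∈ D := invFunOn_mem hy
    refine (HasDerivAt.of_local_left_inverse (hc.continuousAt (hO.mem_nhds hy))
      (hh.differentiableAt (hD.mem_nhds hm)).hasDerivAt hd ?_).differentiableAt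
    filter_upwards [hO.mem_nhds hy] with w hw using hri w hw
  rintro y hy
  have hm : invFunOn h D y ∈ D := invFunOn_mem hy
  have hcy := hc.continuousAt (hO.mem_nhds hy)
  refine (AnalyticAt.differentiableAt ?_).differentiableWithinAt
  -- Zeros of `deriv h` are isolated, since otherwise `h` would be locally constant. The continuous
  -- inverse is thus differentiable on a punctured neighbourhood, and the singularity is removable.
  refine Complex.analyticAt_of_differentiable_on_punctured_nhds_of_continuousAt ?_ hcy
  rcases ((hh.analyticAt (hD.mem_nhds hm)).deriv).eventually_eq_zero_or_eventually_ne_zero with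
    h0 | hne
  · exfalso
    obtain ⟨r, hr, hball⟩ := Metric.eventually_nhds_iff_ball.1 (h0.and (hD.mem_nhds hm))
    refine not_eventually_eq_of_injOn hD hi hm ?_
    filter_upwards [Metric.ball_mem_nhds _ hr] with z hz
    exact Metric.isOpen_ball.is_const_of_deriv_eq_zero (convex_ball _ r).isPreconnected
      (fun w hw => (hh.differentiableAt (hD.mem_nhds (hball w hw).2)).differentiableWithinAt)
      (fun w hw => (hball w hw).1) hz (Metric.mem_ball_self hr)
  · rw [eventually_nhdsWithin_iff] at hne ⊢
    filter_upwards [hcy.eventually hne, hO.mem_nhds hy] with w hw hwD hwy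
    refine hreg w hwD (hw fun heq => hwy ?_)
    have := congrArg h (mem_singleton_iff.1 heq)
    rwa [hri w hwD, hri y hy] at this

theorem HasLogOn.image_of_injOn {L : Set ℂ} {F : ℂ → ℂ} (hLD : L ⊆ D) (hD : IsOpen D)
    (hh : DifferentiableOn ℂ h D) (hi : InjOn h D) (hF : HasLogOn L (fun z => F (h z))) :
    HasLogOn (h '' L) F := by
  have hL : invFunOn h D '' (h '' L) = L := by
    rw [← image_comp]
    exact (image_congr fun z hz => hi.leftInvOn_invFunOn (hLD hz)).trans (image_id L)
  rw [← hL] at hF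
  refine (hF.comp ((continuousOn_invFunOn hD hh hi).mono (image_mono hLD))).congr ?_
  rintro _ ⟨z, hz, rfl⟩
  exact congrArg F (congrArg h (hi.leftInvOn_invFunOn (hLD hz)))

end InverseFunction

/-! ### Iterates near the fixed point and simultaneous approximation -/

namespace IsKoenigsLinearization

variable {f : ℂ → ℂ} {z₀ : ℂ} {U V : Set ℂ} {φ : ℂ → ℂ}

theorem iterate_mem (hU : IsKoenigsLinearization f z₀ U V φ) (n : ℕ) {z : ℂ} (hz : z ∈ U) :
    f^[n] z ∈ U :=
  hU.mapsTo_symbol.iterate n hz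

theorem differentiableOn_iterate (hU : IsKoenigsLinearization f z₀ U V φ) (n : ℕ) :
    DifferentiableOn ℂ f^[n] U :=
  hU.differentiableOn_symbol.iterate hU.mapsTo_symbol n

theorem conj_iterate (hU : IsKoenigsLinearization f z₀ U V φ) (n : ℕ) {z : ℂ} (hz : z ∈ U) :
    φ (f^[n] z) = deriv f z₀ ^ n * φ z := by
  induction n with
  | zero => simp
  | succ n ih => rw [iterate_succ_apply', hU.conj _ (hU.iterate_mem n hz), ih, pow_succ']; ring

theorem injOn_iterate (hU : IsKoenigsLinearization f z₀ U V φ) (hz₀ : IsAttractingFixedPoint f z₀)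
    (n : ℕ) : InjOn f^[n] U := by
  intro z hz w hw h
  refine hU.bijOn.injOn hz hw ?_
  have h1 := congrArg φ h
  rw [hU.conj_iterate n hz, hU.conj_iterate n hw] at h1
  exact mul_left_cancel₀ (pow_ne_zero n (norm_pos_iff.1 hz₀.multiplier_ne_zero)) h1

theorem iterate_ne (hU : IsKoenigsLinearization f z₀ U V φ) (hz₀ : IsAttractingFixedPoint f z₀)
    (n : ℕ) {z : ℂ} (hz : z ∈ U \ {z₀}) : f^[n] z ≠ z₀ := fun h =>
  hz.2 (hU.injOn_iterate hz₀ n hz.1 hU.mem_source (h.trans (iterate_fixed hz₀.isFixedPt n).symm))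

theorem map_center (hU : IsKoenigsLinearization f z₀ U V φ) (hz₀ : IsAttractingFixedPoint f z₀) :
    φ z₀ = 0 := by
  have h1 := hU.conj z₀ hU.mem_source
  rw [hz₀.isFixedPt] at h1
  have h2 : deriv f z₀ ≠ 1 := fun h => by
    have := hz₀.multiplier_lt_one
    rw [h, norm_one] at this
    exact lt_irrefl _ this
  by_contra h0
  exact h2 (mul_right_cancel₀ h0 (by rw [one_mul]; exact h1.symm))

/-- The iterates converge to the fixed point uniformly on compact subsets of the linearization
neighbourhood. -/
theorem exists_iterate_mem_ball (hU : IsKoenigsLinearization f z₀ U V φ)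
    (hz₀ : IsAttractingFixedPoint f z₀) {Q : Set ℂ} (hQ : IsCompact Q) (hQU : Q ⊆ U) {δ : ℝ}
    (hδ : 0 < δ) : ∃ n : ℕ, 1 ≤ n ∧ ∀ z ∈ Q, f^[n] z ∈ Metric.ball z₀ δ := by
  -- Closeness to `z₀` is read off in the linear coordinate: this image contains a disc about `0`,
  -- and `φ ∘ f^n = λ^n φ` tends to `0` uniformly on `Q`.
  have hO : IsOpen (φ '' (U ∩ Metric.ball z₀ δ)) :=
    isOpen_image_of_injOn (hU.isOpen_source.inter Metric.isOpen_ball)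
      (hU.differentiableOn.mono inter_subset_left) (hU.bijOn.injOn.mono inter_subset_left)
  obtain ⟨r, hr, hball⟩ := Metric.isOpen_iff.1 hO 0
    ⟨z₀, ⟨hU.mem_source, Metric.mem_ball_self hδ⟩, hU.map_center hz₀⟩
  obtain ⟨C, hC⟩ := hQ.exists_bound_of_continuousOn (hU.differentiableOn.continuousOn.mono hQU)
  have hlim : Filter.Tendsto (fun n : ℕ => ‖deriv f z₀‖ ^ n * C) Filter.atTop (𝓝 0) := by
    simpa using (tendsto_pow_atTop_nhds_zero_of_lt_one (norm_nonneg _)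
      hz₀.multiplier_lt_one).mul_const C
  obtain ⟨n, hn, hn1⟩ := ((hlim.eventually_lt_const hr).and (Filter.eventually_ge_atTop 1)).exists
  refine ⟨n, hn1, fun z hz => ?_⟩
  have h1 : φ (f^[n] z) ∈ Metric.ball 0 r := by
    rw [hU.conj_iterate n (hQU hz), mem_ball_zero_iff, norm_mul, norm_pow]
    exact (mul_le_mul_of_nonneg_left (hC z hz) (by positivity)).trans_lt hn
  obtain ⟨w, hw, hwe⟩ := hball h1
  exact hU.bijOn.injOn hw.1 (hU.iterate_mem n (hQU hz)) hwe ▸ hw.2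

/-- Simultaneous approximation: a polynomial in `1 / (z - z₀)` which is small on `K` and corrects
`g` along some iterate so as to be close to `u` on `L`. -/
theorem exists_polynomial_approx (hU : IsKoenigsLinearization f z₀ U V φ)
    (hz₀ : IsAttractingFixedPoint f z₀) {L N : Set ℂ} (hL : IsCompact L)
    (hLU : logHull L ⊆ U \ {z₀}) (hN : IsOpen N) (hLN : logHull L ⊆ N) {u : ℂ → ℂ}
    (hu : DifferentiableOn ℂ u N) {g : ℂ → ℂ} (hg : DifferentiableOn ℂ g {z₀}ᶜ) {K : Set ℂ}
    (hK : IsCompact K) (hKz : K ⊆ {z₀}ᶜ) {ε : ℝ} (hε : 0 < ε) :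
    ∃ n : ℕ, 1 ≤ n ∧ ∃ p : Polynomial ℂ, (∀ z ∈ K, ‖p.eval (z - z₀)⁻¹‖ < ε) ∧
      ∀ z ∈ L, ‖g (f^[n] z) + p.eval (f^[n] z - z₀)⁻¹ - u z‖ < ε := by
  classical
  obtain ⟨δ, hδ, hδK⟩ := Metric.isOpen_iff.1 hK.isClosed.isOpen_compl z₀ fun h => hKz h rfl
  have hhull := isCompact_logHull hL
  -- `K` stays at distance at least `δ` from `z₀`. Using `δ / 2` here leaves the gap between the
  -- radii `1 / δ` and `2 / δ` after inversion.
  obtain ⟨n, hn1, hn⟩ := hU.exists_iterate_mem_ball hz₀ hhull (hLU.trans sdiff_subset)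
    (half_pos hδ)
  refine ⟨n, hn1, ?_⟩
  set D := N ∩ (U \ {z₀}) with hDdef
  have hD : IsOpen D := hN.inter (hU.isOpen_source.sdiff isClosed_singleton)
  have hhD : logHull L ⊆ D := subset_inter hLN hLU
  have hLD : L ⊆ D := (subset_logHull L).trans hhD
  have hDU : D ⊆ U := inter_subset_right.trans sdiff_subset
  have hne : ∀ z ∈ D, f^[n] z - z₀ ≠ 0 := fun z hz => sub_ne_zero.2 (hU.iterate_ne hz₀ n hz.2)
  set ψ : ℂ → ℂ := fun z => (f^[n] z - z₀)⁻¹ with hψ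
  have hψd : DifferentiableOn ℂ ψ D :=
    (((hU.differentiableOn_iterate n).mono hDU).sub_const z₀).inv hne
  have hψi : InjOn ψ D := fun z hz w hw h =>
    hU.injOn_iterate hz₀ n (hDU hz) (hDU hw) (sub_left_injective (inv_injective h))
  have hψbig : ∀ z ∈ logHull L, 2 / δ < ‖ψ z‖ := fun z hz => by
    have h1 := hn z hz
    have h2 := norm_pos_iff.2 (hne z (hhD hz))
    rw [Metric.mem_ball, dist_eq_norm] at h1
    rw [hψ, norm_inv, ← inv_div]
    exact inv_strictAnti₀ h2 h1
  set χ := invFunOn ψ D with hχ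
  have hχψ : ∀ z ∈ D, χ (ψ z) = z := fun z hz => hψi.leftInvOn_invFunOn hz
  have hχd : DifferentiableOn ℂ χ (ψ '' D) := differentiableOn_invFunOn hD hψd hψi
  have hδ2 : 1 / δ < 2 / δ := by gcongr; norm_num
  set B := Metric.closedBall (0 : ℂ) (1 / δ) with hB
  -- The Runge target: no change on the disc containing the image of `K`, and the missing
  -- correction, in the coordinate `w = ψ z`, beyond radius `2 / δ`.
  set F : ℂ → ℂ := (Metric.ball (0 : ℂ) (2 / δ)).piecewise (fun _ => 0)
    (fun w => u (χ w) - g (f^[n] (χ w))) with hF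
  have hO₁ : IsOpen (Metric.ball (0 : ℂ) (2 / δ)) := Metric.isOpen_ball
  have hO₂ : IsOpen (ψ '' D ∩ {w | 2 / δ < ‖w‖}) :=
    (isOpen_image_of_injOn hD hψd hψi).inter (isOpen_lt continuous_const continuous_norm)
  have hFd : DifferentiableOn ℂ F
      (Metric.ball (0 : ℂ) (2 / δ) ∪ ψ '' D ∩ {w | 2 / δ < ‖w‖}) := by
    refine DifferentiableOn.union_of_isOpen ?_ ?_ hO₁ hO₂
    · exact (differentiableOn_const 0).congr fun w hw => piecewise_eq_of_mem _ _ _ hw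
    · have hmaps : MapsTo χ (ψ '' D ∩ {w | 2 / δ < ‖w‖}) D := by
        rintro _ ⟨⟨z, hz, rfl⟩, -⟩
        rwa [hχψ z hz]
      have h1 : DifferentiableOn ℂ (fun z => u z - g (f^[n] z)) D := by
        refine (hu.mono inter_subset_left).sub
          (hg.comp ((hU.differentiableOn_iterate n).mono hDU) fun z hz => ?_)
        exact hU.iterate_ne hz₀ n hz.2
      refine (h1.comp (hχd.mono inter_subset_left) hmaps).congr fun w hw => ?_
      refine piecewise_eq_of_notMem _ _ _ fun hw' => ?_
      exact (mem_ball_zero_iff.1 hw').not_gt hw.2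
  have hcB : IsCompact B := isCompact_closedBall _ _
  have hcM : IsCompact (ψ '' logHull L) :=
    hhull.image_of_continuousOn (hψd.continuousOn.mono hhD)
  have hcL : IsCompact (ψ '' L) := hL.image_of_continuousOn (hψd.continuousOn.mono hLD)
  have hlog : ∀ b ∉ B ∪ ψ '' logHull L, HasLogOn (B ∪ ψ '' L) (fun z => z - b) := by
    intro b hb
    rw [mem_union, not_or] at hb
    refine HasLogOn.union hcB.isClosed hcL.isClosed ?_ ?_ ?_
    · rw [disjoint_left]
      rintro _ hw ⟨z, hz, rfl⟩
      have h1 := hψbig z (subset_logHull L hz)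
      have h2 := mem_closedBall_zero_iff.1 hw
      linarith
    · refine HasLogOn.sub_of_norm_lt fun w hw => ?_
      rw [hB, mem_closedBall_zero_iff, not_le] at hb
      exact (mem_closedBall_zero_iff.1 hw).trans_lt hb.1
    · refine HasLogOn.image_of_injOn hLD hD hψd hψi ?_
      -- `ψ - b` has no zeros on the whole hull of `L`, because `b` avoids the image of the hull and
      -- not just that of `L`.
      refine hasLogOn_of_differentiableOn (subset_logHull L) hhull hD hhD (hψd.sub_const b)
        (fun c hc => notMem_logHull.1 hc) fun z hz h => hb.2 ⟨z, hz, sub_eq_zero.1 h⟩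
  have hMO : ψ '' logHull L ⊆ ψ '' D ∩ {w | 2 / δ < ‖w‖} := by
    rintro _ ⟨z, hz, rfl⟩
    exact ⟨mem_image_of_mem ψ (hhD hz), hψbig z hz⟩
  obtain ⟨p, hp⟩ := exists_polynomial_norm_sub_lt (hcB.union hcL)
    (union_subset_union_right B (image_mono (subset_logHull L))) (hcB.union hcM) (hO₁.union hO₂)
    (union_subset_union (Metric.closedBall_subset_ball hδ2) hMO) hFd hlog hε
  refine ⟨p, fun z hz => ?_, fun z hz => ?_⟩
  · have hzδ : δ ≤ ‖z - z₀‖ := by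
      by_contra hlt
      refine hδK ?_ hz
      rw [Metric.mem_ball, dist_eq_norm]
      exact not_le.1 hlt
    have hzB : (z - z₀)⁻¹ ∈ B := by
      rw [hB, mem_closedBall_zero_iff, norm_inv, ← one_div]
      gcongr
    have h1 := hp _ (Or.inl hzB)
    rwa [hF, piecewise_eq_of_mem _ _ _ (Metric.closedBall_subset_ball hδ2 hzB), sub_zero] at h1
  · have h1 := hp _ (Or.inr (mem_image_of_mem ψ hz))
    have h2 : ψ z ∉ Metric.ball (0 : ℂ) (2 / δ) := fun h =>
      (mem_ball_zero_iff.1 h).not_gt (hψbig z (subset_logHull L hz))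
    rw [hF, piecewise_eq_of_notMem _ _ _ h2, hχψ z (hLD hz)] at h1
    convert h1 using 2
    ring

end IsKoenigsLinearization

/-! ### The Baire property and a countable family of compact sets -/

/-- Locally uniform limits of holomorphic functions are holomorphic; the extension by `0` only
serves to work with functions on `ℂ`. -/
theorem isClosed_hol {Ω : Set ℂ} (hΩ : IsOpen Ω) : IsClosed (Hol Ω) := by
  classical
  have : LocallyCompactSpace Ω := hΩ.locallyCompactSpace
  rw [isClosed_iff_clusterPt]
  intro g hg
  set ext : C(Ω, ℂ) → ℂ → ℂ := fun u z => if hz : z ∈ Ω then u ⟨z, hz⟩ else 0 with hext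
  have hval : ∀ (u : C(Ω, ℂ)) (z : Ω), ext u z = u z := fun u z => by simp [hext]
  have hlim : TendstoLocallyUniformly (fun u : C(Ω, ℂ) => (u : Ω → ℂ)) g
      (𝓝 g ⊓ Filter.principal (Hol Ω)) :=
    ContinuousMap.tendsto_iff_tendstoLocallyUniformly.1 (Filter.tendsto_id.mono_left inf_le_left)
  have hlim' : TendstoLocallyUniformlyOn ext (ext g) (𝓝 g ⊓ Filter.principal (Hol Ω)) Ω := by
    rw [tendstoLocallyUniformlyOn_iff_tendstoLocallyUniformly_comp_coe]
    simpa only [Function.comp_def, hval] using hlim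
  have hne : (𝓝 g ⊓ Filter.principal (Hol Ω)).NeBot := hg
  refine ⟨ext g, hlim'.differentiableOn ?_ hΩ, hval g⟩
  filter_upwards [Filter.mem_inf_of_right (Filter.mem_principal_self (Hol Ω))] with u hu
  obtain ⟨G, hG, hGu⟩ := hu
  exact hG.congr fun z hz => by rw [hGu ⟨z, hz⟩, ← hval u ⟨z, hz⟩]

theorem baireSpace_hol {Ω : Set ℂ} (hΩ : IsOpen Ω) : BaireSpace (Hol Ω) := by
  have : LocallyCompactSpace Ω := hΩ.locallyCompactSpace
  have : CompleteSpace (Hol Ω) := (isClosed_hol hΩ).completeSpace_coe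
  infer_instance

theorem ContinuousMap.exists_compact_of_mem_nhds {X : Type*} [TopologicalSpace X] {g : C(X, ℂ)}
    {s : Set C(X, ℂ)} (hs : s ∈ 𝓝 g) :
    ∃ K : Set X, IsCompact K ∧ ∃ ε > 0, ∀ u : C(X, ℂ), (∀ x ∈ K, ‖u x - g x‖ < ε) → u ∈ s := by
  obtain ⟨S, hS, hSs⟩ := UniformSpace.mem_nhds_iff.1 hs
  obtain ⟨K, V, hK, hV, hKV⟩ := (ContinuousMap.mem_compactConvergence_entourage_iff S).1 hS
  obtain ⟨ε, hε, hεV⟩ := Metric.mem_uniformity_dist.1 hV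
  refine ⟨K, hK, ε, hε, fun u hu => hSs (hKV fun x hx => hεV ?_)⟩
  rw [dist_comm, dist_eq_norm]
  exact hu x hx

/-- Finite unions of closed balls taken from a fixed countable family. -/
noncomputable def ballUnion (t : Finset (ℕ × ℕ)) : Set ℂ :=
  ⋃ i ∈ t, Metric.closedBall (TopologicalSpace.denseSeq ℂ i.1) (1 / ((i.2 : ℝ) + 1))

theorem isCompact_ballUnion (t : Finset (ℕ × ℕ)) : IsCompact (ballUnion t) :=
  t.isCompact_biUnion fun _ _ => isCompact_closedBall _ _

instance (t : Finset (ℕ × ℕ)) : CompactSpace (ballUnion t) :=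
  isCompact_iff_compactSpace.1 (isCompact_ballUnion t)

/-- This reduces uniform approximation on arbitrary compact subsets of arbitrary `W` to countably
many compact sets. -/
theorem exists_ballUnion_between {K W : Set ℂ} (hK : IsCompact K) (hW : IsOpen W) (hKW : K ⊆ W) :
    ∃ t : Finset (ℕ × ℕ), K ⊆ ballUnion t ∧ ballUnion t ⊆ W := by
  set c : ℕ × ℕ → ℂ := fun i => TopologicalSpace.denseSeq ℂ i.1
  set ρ : ℕ × ℕ → ℝ := fun i => 1 / ((i.2 : ℝ) + 1)
  obtain ⟨b, hbW, hbf, hKb⟩ := hK.elim_finite_subcover_image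
    (b := {i | Metric.closedBall (c i) (ρ i) ⊆ W}) (c := fun i => Metric.ball (c i) (ρ i))
    (fun _ _ => Metric.isOpen_ball) (fun x hx => by
      obtain ⟨ε, hε, hball⟩ := Metric.isOpen_iff.1 hW x (hKW hx)
      obtain ⟨k, hk⟩ := exists_nat_one_div_lt (half_pos hε)
      obtain ⟨i, hi⟩ := (TopologicalSpace.denseRange_denseSeq ℂ).exists_dist_lt x
        (Nat.one_div_pos_of_nat (α := ℝ) (n := k))
      refine mem_iUnion₂.2 ⟨(i, k), fun y hy => hball ?_, hi⟩
      have h1 : dist y (c (i, k)) ≤ 1 / ((k : ℝ) + 1) := hy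
      have h2 : dist (c (i, k)) x < 1 / ((k : ℝ) + 1) := by rw [dist_comm]; exact hi
      have h3 := dist_triangle y (c (i, k)) x
      rw [Metric.mem_ball]
      linarith)
  refine ⟨hbf.toFinset, fun x hx => ?_, iUnion₂_subset fun i hi => hbW (hbf.mem_toFinset.1 hi)⟩
  obtain ⟨i, hi, hxi⟩ := mem_iUnion₂.1 (hKb hx)
  exact mem_iUnion₂.2 ⟨i, hbf.mem_toFinset.2 hi, Metric.ball_subset_closedBall hxi⟩

/-! ### Visiting sets and the category argument -/

/-- The functions `g` for which some `g ∘ f^n`, `n ≥ 1`, belongs to `O` on `L`. -/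
def visiting (f : ℂ → ℂ) (Ω : Set ℂ) {L : Set ℂ} (O : Set C(L, ℂ)) : Set (Hol Ω) :=
  {g | (compOrbit f L (g : C(Ω, ℂ)) ∩ O).Nonempty}

namespace IsKoenigsLinearization

variable {f : ℂ → ℂ} {z₀ : ℂ} {U V : Set ℂ} {φ : ℂ → ℂ}

theorem mapsTo_iterate (hU : IsKoenigsLinearization f z₀ U V φ)
    (hz₀ : IsAttractingFixedPoint f z₀) {M : Set ℂ} (hM : M ⊆ U \ {z₀}) (n : ℕ) :
    MapsTo f^[n] M {z₀}ᶜ := fun _ hz => hU.iterate_ne hz₀ n (hM hz)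

/-- The map `f^n : M → ℂ ∖ {z₀}` for `M ⊆ U ∖ {z₀}`. -/
def iterateMap (hU : IsKoenigsLinearization f z₀ U V φ)
    (hz₀ : IsAttractingFixedPoint f z₀) {M : Set ℂ} (hM : M ⊆ U \ {z₀}) (n : ℕ) :
    C(M, ({z₀}ᶜ : Set ℂ)) :=
  ⟨(hU.mapsTo_iterate hz₀ hM n).restrict _ _ _,
    ((hU.differentiableOn_iterate n).continuousOn.mono
      (hM.trans sdiff_subset)).mapsToRestrict _⟩

theorem comp_iterateMap_mem_compOrbit (hU : IsKoenigsLinearization f z₀ U V φ)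
    (hz₀ : IsAttractingFixedPoint f z₀) {M : Set ℂ} (hM : M ⊆ U \ {z₀}) {n : ℕ} (hn : 1 ≤ n)
    (g : C(({z₀}ᶜ : Set ℂ), ℂ)) : g.comp (hU.iterateMap hz₀ hM n) ∈ compOrbit f M g :=
  ⟨n, hn, hU.mapsTo_iterate hz₀ hM n, fun _ => rfl⟩

theorem exists_eq_comp_iterateMap (hU : IsKoenigsLinearization f z₀ U V φ)
    (hz₀ : IsAttractingFixedPoint f z₀) {M : Set ℂ} (hM : M ⊆ U \ {z₀})
    {g : C(({z₀}ᶜ : Set ℂ), ℂ)} {u : C(M, ℂ)} (hu : u ∈ compOrbit f M g) :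
    ∃ n, 1 ≤ n ∧ u = g.comp (hU.iterateMap hz₀ hM n) := by
  obtain ⟨n, hn, h, hz⟩ := hu
  exact ⟨n, hn, ContinuousMap.ext hz⟩

/-- A union over `n` of preimages of `O` under `g ↦ g ∘ f^n`, which is continuous. -/
theorem isOpen_visiting (hU : IsKoenigsLinearization f z₀ U V φ)
    (hz₀ : IsAttractingFixedPoint f z₀) {L : Set ℂ} (hL : L ⊆ U \ {z₀}) {O : Set C(L, ℂ)}
    (hO : IsOpen O) : IsOpen (visiting f {z₀}ᶜ O) := by
  have : visiting f {z₀}ᶜ O = ⋃ (n : ℕ) (_ : 1 ≤ n),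
      {g : Hol {z₀}ᶜ | (g : C(({z₀}ᶜ : Set ℂ), ℂ)).comp (hU.iterateMap hz₀ hL n) ∈ O} := by
    ext g
    simp only [mem_iUnion, mem_ofPred_eq]
    constructor
    · rintro ⟨u, hu, huO⟩
      obtain ⟨n, hn, rfl⟩ := hU.exists_eq_comp_iterateMap hz₀ hL hu
      exact ⟨n, hn, huO⟩
    · rintro ⟨n, hn, h⟩
      exact ⟨_, hU.comp_iterateMap_mem_compOrbit hz₀ hL hn g, h⟩
  rw [this]
  refine isOpen_iUnion fun n => isOpen_iUnion fun _ => ?_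
  exact hO.preimage ((ContinuousMap.continuous_precomp _).comp continuous_subtype_val)

/-- A polynomial in `1 / (z - z₀)` is holomorphic off `z₀`, so it may be added to `g₀`: small on the
compact set that tests closeness to `g₀`, it steers an iterate into `O`. -/
theorem dense_visiting (hU : IsKoenigsLinearization f z₀ U V φ)
    (hz₀ : IsAttractingFixedPoint f z₀) {L N : Set ℂ} (hLc : IsCompact L)
    (hL : logHull L ⊆ U \ {z₀}) {O : Set C(L, ℂ)} (hO : IsOpen O) (hN : IsOpen N)
    (hLN : logHull L ⊆ N) {u : ℂ → ℂ} (hu : DifferentiableOn ℂ u N) {r : C(L, ℂ)} (hr : r ∈ O)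
    (hru : ∀ z : L, r z = u z) : Dense (visiting f {z₀}ᶜ O) := by
  intro g₀
  rw [mem_closure_iff_nhds]
  intro s hs
  obtain ⟨s', hs', hss'⟩ := mem_nhds_subtype _ _ _ |>.1 hs
  obtain ⟨K, hK, ε, hε, hKε⟩ := ContinuousMap.exists_compact_of_mem_nhds hs'
  obtain ⟨Q, -, η, hη, hQη⟩ := ContinuousMap.exists_compact_of_mem_nhds (hO.mem_nhds hr)
  obtain ⟨G, hG, hGg⟩ := g₀.2
  obtain ⟨n, hn, p, hp, hpL⟩ := hU.exists_polynomial_approx hz₀ hLc hL hN hLN hu hG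
    (hK.image continuous_subtype_val) (by rintro _ ⟨z, -, rfl⟩; exact z.2) (lt_min hε hη)
  have hdiff : DifferentiableOn ℂ (fun z => G z + p.eval (z - z₀)⁻¹) {z₀}ᶜ :=
    hG.add (p.differentiable.comp_differentiableOn
      ((differentiableOn_id.sub_const z₀).inv fun z hz => sub_ne_zero.2 hz))
  set g : Hol {z₀}ᶜ := ⟨⟨_, continuousOn_iff_continuous_domRestrict.1 hdiff.continuousOn⟩,
    _, hdiff, fun z => rfl⟩ with hg
  have hgv : ∀ z : ({z₀}ᶜ : Set ℂ), (g : C(({z₀}ᶜ : Set ℂ), ℂ)) z =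
    G z + p.eval ((z : ℂ) - z₀)⁻¹ := fun z => rfl
  have hLU := (subset_logHull L).trans hL
  refine ⟨g, hss' (hKε g fun z hz => ?_),
    _, hU.comp_iterateMap_mem_compOrbit hz₀ hLU hn g, hQη _ fun z _ => ?_⟩
  · rw [hgv, ← hGg, add_sub_cancel_left]
    exact (hp z (mem_image_of_mem _ hz)).trans_le (min_le_left _ _)
  · rw [ContinuousMap.comp_apply, hgv, hru]
    exact (hpL z z.2).trans_le (min_le_right _ _)

/-- It suffices to visit the members of a countable family of open sets. -/
theorem isUniversalFor_of_visiting (hU : IsKoenigsLinearization f z₀ U V φ)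
    (hz₀ : IsAttractingFixedPoint f z₀) {g : Hol ({z₀}ᶜ : Set ℂ)}
    (hg : ∀ t : Finset (ℕ × ℕ), logHull (ballUnion t) ⊆ U \ {z₀} →
      ∀ O ∈ TopologicalSpace.countableBasis C(ballUnion t, ℂ),
      ∀ N, IsOpen N → logHull (ballUnion t) ⊆ N → ∀ u : ℂ → ℂ, DifferentiableOn ℂ u N →
      ∀ r ∈ O, (∀ z : ballUnion t, r z = u z) → g ∈ visiting f {z₀}ᶜ O)
    {W : Set ℂ} (hW : IsOpen W) (hWU : W ⊆ U \ {z₀}) (hWh : HasNoHoles W) :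
    IsUniversalFor f (Hol W) g := by
  rintro h ⟨H, hH, hHh⟩
  rw [mem_closure_iff_nhds]
  intro s hs
  obtain ⟨K, hK, ε, hε, hKε⟩ := ContinuousMap.exists_compact_of_mem_nhds hs
  obtain ⟨t, hKt, htW⟩ := exists_ballUnion_between (hK.image continuous_subtype_val) hW
    (by rintro _ ⟨z, -, rfl⟩; exact z.2)
  -- Without holes, `W` contains the hull, so `H` is holomorphic near it and `W` itself serves as
  -- `N`.
  have hhull : logHull (ballUnion t) ⊆ W :=
    logHull_subset_of_hasNoHoles (isCompact_ballUnion t) htW hWh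
  set r : C(ballUnion t, ℂ) := h.comp ⟨inclusion htW, continuous_inclusion htW⟩ with hr
  have hrH : ∀ z : ballUnion t, r z = H z := fun z => (hHh (inclusion htW z)).symm
  obtain ⟨O, hOb, hrO, hO⟩ :=
    (TopologicalSpace.isBasis_countableBasis C(ballUnion t, ℂ)).mem_nhds_iff.1
      (Metric.ball_mem_nhds r hε)
  obtain ⟨v, hv, hvO⟩ := hg t (hhull.trans hWU) O hOb W hW hhull H hH r hrO hrH
  obtain ⟨n, hn, rfl⟩ := hU.exists_eq_comp_iterateMap hz₀ (htW.trans hWU) hv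
  refine ⟨_, hKε _ fun z hz => ?_, hU.comp_iterateMap_mem_compOrbit hz₀ hWU hn g⟩
  have hzt : (z : ℂ) ∈ ballUnion t := hKt (mem_image_of_mem _ hz)
  have h1 := (ContinuousMap.dist_apply_le_dist ⟨z, hzt⟩).trans_lt (Metric.mem_ball.1 (hO hvO))
  rw [dist_eq_norm] at h1
  exact h1

end IsKoenigsLinearization

theorem mainTheorem4 (f : ℂ → ℂ) (z₀ : ℂ) (hz₀ : IsAttractingFixedPoint f z₀)
    (U V : Set ℂ) (φ : ℂ → ℂ) (hU : IsKoenigsLinearization f z₀ U V φ) :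
    IsComeager {g : Hol ({z₀}ᶜ : Set ℂ) |
      ∀ W : Set ℂ, IsOpen W → W ⊆ U \ {z₀} → HasNoHoles W → IsUniversalFor f (Hol W) g} := by
  have : BaireSpace (Hol ({z₀}ᶜ : Set ℂ)) := baireSpace_hol isOpen_compl_singleton
  have (t : Finset (ℕ × ℕ)) : Countable (TopologicalSpace.countableBasis C(ballUnion t, ℂ)) :=
    (TopologicalSpace.countable_countableBasis _).to_subtype
  -- Only basic open sets containing a function holomorphic near the hull are imposed; density is
  -- not available for the others. The index set remains countable.
  set good : (Σ t : Finset (ℕ × ℕ), TopologicalSpace.countableBasis C(ballUnion t, ℂ)) → Prop :=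
    fun i => logHull (ballUnion i.1) ⊆ U \ {z₀} ∧ ∃ N, IsOpen N ∧ logHull (ballUnion i.1) ⊆ N ∧
      ∃ u : ℂ → ℂ, DifferentiableOn ℂ u N ∧
        ∃ r ∈ (i.2 : Set C(ballUnion i.1, ℂ)), ∀ z : ballUnion i.1, r z = u z with hgood
  have hopen : ∀ i : {i // good i}, IsOpen (visiting f {z₀}ᶜ (i.1.2 : Set C(ballUnion i.1.1, ℂ))) :=
    fun i => hU.isOpen_visiting hz₀ ((subset_logHull _).trans i.2.1)
      (TopologicalSpace.isOpen_of_mem_countableBasis i.1.2.2)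
  refine ⟨⋂ i : {i // good i}, visiting f {z₀}ᶜ (i.1.2 : Set C(ballUnion i.1.1, ℂ)), ?_,
    .iInter_of_isOpen hopen, dense_iInter_of_isOpen hopen ?_⟩
  · intro g hg W hW hWU hWh
    refine hU.isUniversalFor_of_visiting hz₀ ?_ hW hWU hWh
    intro t ht O hO N hN hLN u hu r hr hru
    exact mem_iInter.1 hg ⟨⟨t, O, hO⟩, ht, N, hN, hLN, u, hu, r, hr, hru⟩
  · rintro ⟨i, hi, N, hN, hLN, u, hu, r, hr, hru⟩
    exact hU.dense_visiting hz₀ (isCompact_ballUnion _) hi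
      (TopologicalSpace.isOpen_of_mem_countableBasis i.2.2) hN hLN hu hr hru
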